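/- Represent the unit square $[x,x+1]\times[y,y+1]$ ($x,y\in\mathbb Z$) by $(x,y)$, and let $n\ge 0$ be an integer. Let $Q_n$ be the part above the zig-zag cut of the $2n\times 2n$ square, i.e. the set of unit squares $(x,y)$ with $0\le x,y<2n$ and either $x<y$, or $x=y$ with $x$ even. Let $A_k$ be the top half of the Aztec diamond of order $k$, i.e. the set of unit squares contained in $\{|x|+|y|\le k+1,\ y\ge 0\}$. The Aztec triangle of order $n$ is $\mathcal T_n=Q_n\cup\big(A_{n-1}+(n,2n)\big)$ (the half diamond sits on top of $Q_n$, right-justified), and its left-justified variant is $\mathcal T'_n=Q_n\cup\big(A_{n-1}+(n-1,2n)\big)$ (for $n=0$ both regions are empty). A domino tiling of a region $R$ is a set of dominoes (pairs of unit squares sharing an edge) contained in $R$ such that each unit square of $R$ lies in exactly one of them. Given a tiling $t$ and a set $S$ of unit squares, glide from each $s\in S$: from a current square $c$ covered by a domino $\{c,c+d\}\in t$ move straight on to $c+2d$, and repeat for as long as the current square is covered by a domino of $t$. Let $\operatorname{sh}_S(t)$ be obtained from $t$ by replacing each domino $\{c,c+d\}$ followed from a visited square $c$ by $\{c+d,c+2d\}$,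 and keeping all the dominoes of $t$ that contain no visited square. Then for every $n$ the map $t\mapsto \operatorname{sh}_{\mathcal T_n\setminus\mathcal T'_n}(t)$ is a (well-defined) bijection from the set of domino tilings of $\mathcal T_n$ to the set of domino tilings of $\mathcal T'_n$, and its inverse is $t'\mapsto \operatorname{sh}_{\mathcal T'_n\setminus\mathcal T_n}(t')$. -/

import Mathlib

namespace AztecTriangle

/-- The unit square `[x, x + 1] × [y, y + 1]` of the square lattice is represented by its
lower left corner `(x, y)`. -/
abbrev Cell : Type := ℤ × ℤ

/-- The part above the zig-zag cut of the lattice square `[0, 2n] × [0, 2n]`: all unit squares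
strictly above the diagonal `y = x`, together with every second diagonal square, starting with the
one in the lower left corner. (The part below the cut is its image under the half-turn about the
centre `(n, n)`.) -/
def halfSquare (n : ℤ) : Set Cell :=
  {c | (0 ≤ c.1 ∧ c.1 < 2 * n) ∧ (0 ≤ c.2 ∧ c.2 < 2 * n) ∧ (c.1 < c.2 ∨ (c.1 = c.2 ∧ Even c.1))}

/-- The Aztec diamond of order `k`, centred at the origin: all unit squares contained in
`{|x| + |y| ≤ k + 1}`. -/
def aztecDiamond (k : ℤ) : Set Cell :=
  {c | max |c.1| |c.1 + 1| + max |c.2| |c.2 + 1| ≤ k + 1}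

/-- The top half of the Aztec diamond of order `k`; its rows, from bottom to top, consist of
`2k, 2k - 2, …, 2` unit squares, and the bottom row is `{-k, …, k - 1} × {0}`. -/
def topHalfAztecDiamond (k : ℤ) : Set Cell :=
  {c | c ∈ aztecDiamond k ∧ 0 ≤ c.2}

/-- The region `R` translated by the vector `v`. -/
def translateRegion (v : ℤ × ℤ) (R : Set Cell) : Set Cell :=
  {c | c - v ∈ R}

/-- The Aztec triangle `𝒯ₙ`: the top half of the Aztec diamond of order `n - 1` sits on the top row
`{0, …, 2n - 2} × {2n - 1}` of the half square, right-justified (its bottom row is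
`{1, …, 2n - 2} × {2n}`). -/
def triangle (n : ℕ) : Set Cell :=
  halfSquare n ∪ translateRegion ((n : ℤ), 2 * (n : ℤ)) (topHalfAztecDiamond ((n : ℤ) - 1))

/-- The variant `𝒯'ₙ`: the same, but left-justified (the bottom row of the half Aztec diamond is
`{0, …, 2n - 3} × {2n}`). -/
def triangle' (n : ℕ) : Set Cell :=
  halfSquare n ∪ translateRegion ((n : ℤ) - 1, 2 * (n : ℤ)) (topHalfAztecDiamond ((n : ℤ) - 1))

/-- A domino is the union of two unit squares sharing an edge. -/
def IsDomino (D : Set Cell) : Prop :=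
  ∃ c : Cell, D = {c, c + (1, 0)} ∨ D = {c, c + (0, 1)}

/-- A domino tiling of the region `R`: a set of dominoes contained in `R` such that every unit
square of `R` belongs to exactly one of them. -/
@[ext]
structure DominoTiling (R : Set Cell) where
  tiles : Set (Set Cell)
  isDomino : ∀ D ∈ tiles, IsDomino D
  subset : ∀ D ∈ tiles, D ⊆ R
  existsUnique_mem : ∀ c ∈ R, ∃! D : Set Cell, D ∈ tiles ∧ c ∈ D

/-- One gliding step: from the unit square `c`, follow the domino `{c, c + d}` of `t` that
covers `c`, and continue straight on, to the unit square `c + 2d`. -/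
def GlideStep (t : Set (Set Cell)) (c c' : Cell) : Prop :=
  ∃ d : ℤ × ℤ, ({c, c + d} : Set Cell) ∈ t ∧ c' = c + d + d

/-- `c` is visited by the gliding path of `t` (the iteration of gliding steps, until one gets
stuck) that starts at some unit square of `S`. -/
def Visited (t : Set (Set Cell)) (S : Set Cell) (c : Cell) : Prop :=
  ∃ s ∈ S, Relation.ReflTransGen (GlideStep t) s c

/-- Shifting `t` along its gliding paths that start in `S`: each domino `{c, c + d}` that is
followed from a visited square `c` is replaced by the other half `{c + d, c + 2d}` of that gliding
step; all dominoes which are not on the gliding paths are kept. -/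
def shift (t : Set (Set Cell)) (S : Set Cell) : Set (Set Cell) :=
  {D | D ∈ t ∧ ∀ c ∈ D, ¬ Visited t S c} ∪
    {D | ∃ c d : ℤ × ℤ, Visited t S c ∧ ({c, c + d} : Set Cell) ∈ t ∧ D = {c + d, c + d + d}}

end AztecTriangle

/-! Colour the unit square `(x, y)` by the parity of `x + y`. All starting squares are even, and
gliding from `c` to `c + 2d` preserves the parities of both coordinates, so there are two kinds of
gliding paths, through the squares with both coordinates even and through those with both odd. Two
paths of different kinds cannot cross: they could only do so in an odd square, which would then be
covered by two dominoes.

A tiling of `𝒯ₙ` is extended to `halfSquare n ∪ {y ≥ 2n}` by matching every even square outside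
`𝒯ₙ` with its left neighbour. Then all paths come in from the far right on a row `y ≥ 2n`
(`incoming`) and outside a bounded box they glide to the left; the paths of `𝒯ₙ` starting at
`𝒯ₙ \ 𝒯'ₙ` are the parts inside `𝒯ₙ` of those on rows on which `𝒯ₙ` has squares. Everything is
reduced to the following fact (`GlideSystem.snd_eq_of_left`, `GlideSystem.glide_injective`): the
path coming in on row `y` leaves to the far left on row `y`, and different paths are disjoint.

The planarity behind this fact is expressed by a discrete height function. A set `V` of even
squares on which gliding is a bijection carries a flow without sources or sinks, and
`flowBelow d V x y` is the net flow of `V` across the vertical ray going down from `(x, y)`. Gliding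
from a square whose path avoids `V` does not change this number (`flowBelow_glide`), and it
vanishes outside the region, as the region is closed under going up. There are three consequences.
* There are no cycles (`iterate_ne_self`): a cycle encloses squares of the other kind, whose paths
  are trapped, hence contain a cycle with a larger minimal height, and so on.
* Paths do not leave through the bottom (`incoming_subset`). For even-even paths this is the shape
  of the zig-zag cut; the others start above the lowest incoming path and have to stay above it.
* Incoming paths of different kinds keep their vertical order (`lt_iff_lt`). Consecutive rows have
  different kinds, so the outgoing row is a strictly increasing function of the incoming row. It is
  the identity on high rows, and no outgoing row is below `2n`, so it is the identity.

The variant `𝒯'ₙ` is treated by reflecting it in the line `x = n - 1/2`, mapping the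
square `(x, y)` to `(2n - 2 - x, y)`: this takes its half Aztec diamond to the one of `𝒯ₙ`, and the
properties of `halfSquare n` that are used (`IsBase`) hold for its mirror image too. Finally, the
properties of the gliding paths collected in `Transports` imply that the shift is a tiling of the
other region and that the reverse shift walks back the same paths (`DominoTiling.shiftTiling`,
`DominoTiling.shift_shift`). -/

namespace AztecTriangle

open Set

/-! ### Gliding in a matched region -/

/-- The end of the gliding step from `c` if the domino covering `c` is `{c, c + d c}`. -/
def glide (d : Cell → Cell) (c : Cell) : Cell := c + d c + d c

/-- One of the four unit vectors of the square lattice. -/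
def IsUnitVector (v : Cell) : Prop := v = (1, 0) ∨ v = (-1, 0) ∨ v = (0, 1) ∨ v = (0, -1)

/-- A partial matching of the region `Ω`, in which every even square `c` is matched with the odd
square `c + d c`. (The values of `d` elsewhere are irrelevant.) The region is closed under going up
and contains the half-plane above the even height `Y₀`. Outside the box `-X < x < X`, `y < Y` all
even squares are matched with their left neighbours, and there is no exit from `Ω` for gliding
paths through squares with both coordinates even. -/
structure GlideSystem (Ω : Set Cell) (d : Cell → Cell) (X Y Y₀ : ℤ) : Prop where
  isUnitVector : ∀ c ∈ Ω, Even (c.1 + c.2) → IsUnitVector (d c)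
  add_mem : ∀ c ∈ Ω, Even (c.1 + c.2) → c + d c ∈ Ω
  inj : ∀ c ∈ Ω, ∀ c' ∈ Ω, Even (c.1 + c.2) → Even (c'.1 + c'.2) → c + d c = c' + d c' → c = c'
  up : ∀ x y y', (x, y) ∈ Ω → y ≤ y' → (x, y') ∈ Ω
  nonneg : ∀ c ∈ Ω, 0 ≤ c.2
  glide_mem : ∀ c ∈ Ω, Even c.1 → Even c.2 → glide d c ∈ Ω
  left : ∀ c ∈ Ω, Even (c.1 + c.2) → (c.1 ≤ -X ∨ X ≤ c.1 ∨ Y ≤ c.2) → d c = (-1, 0)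
  top : ∀ x y, Y₀ ≤ y → (x, y) ∈ Ω
  low : ∀ c ∈ Ω, c.1 ≤ -X → Y₀ ≤ c.2
  even_bottom : Even Y₀

lemma glide_fst (d : Cell → Cell) (c : Cell) : (glide d c).1 = c.1 + 2 * (d c).1 := by
  simp [glide]; ring

lemma glide_snd (d : Cell → Cell) (c : Cell) : (glide d c).2 = c.2 + 2 * (d c).2 := by
  simp [glide]; ring

lemma even_glide {d : Cell → Cell} {c : Cell} (h : Even (c.1 + c.2)) :
    Even ((glide d c).1 + (glide d c).2) := by
  rw [glide_fst, glide_snd]; grind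

lemma even_iterate {d : Cell → Cell} {c : Cell} (h : Even (c.1 + c.2)) (k : ℕ) :
    Even (((glide d)^[k] c).1 + ((glide d)^[k] c).2) := by
  induction k with
  | zero => simpa
  | succ k ih => rw [Function.iterate_succ_apply']; exact even_glide ih

lemma even_iterate_snd (d : Cell → Cell) (c : Cell) (k : ℕ) :
    Even ((glide d)^[k] c).2 ↔ Even c.2 := by
  induction k with
  | zero => simp
  | succ k ih => rw [Function.iterate_succ_apply', glide_snd, ← ih]; grind

/-! ### The flow of a set of gliding paths -/

open Classical in
/-- The net flow to the right through the odd square `(x, y)` of the gliding steps which start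
in `V`. -/
noncomputable def flowX (d : Cell → Cell) (V : Set Cell) (x y : ℤ) : ℤ :=
  (if (x - 1, y) ∈ V ∧ d (x - 1, y) = (1, 0) then 1 else 0) -
    (if (x + 1, y) ∈ V ∧ d (x + 1, y) = (-1, 0) then 1 else 0)

open Classical in
/-- The net flow upwards through the odd square `(x, y)` of the gliding steps which start
in `V`. -/
noncomputable def flowY (d : Cell → Cell) (V : Set Cell) (x y : ℤ) : ℤ :=
  (if (x, y - 1) ∈ V ∧ d (x, y - 1) = (0, 1) then 1 else 0) -
    (if (x, y + 1) ∈ V ∧ d (x, y + 1) = (0, -1) then 1 else 0)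

/-- The net flow to the right, across the vertical ray going down from `(x, y)`, of the gliding steps
which start in `V`. Only the squares `(x, y - 1)`, `(x, y - 3)`, … are counted: for even `(x, y)` and
`V` consisting of even squares, these are the ones in which steps can cross the ray. The sum may
stop at height `0`, below which there are no squares of the region. -/
noncomputable def flowBelow (d : Cell → Cell) (V : Set Cell) (x y : ℤ) : ℤ :=
  ∑ k ∈ Finset.range y.toNat, flowX d V x (y - 1 - 2 * k)

variable {Ω : Set Cell} {d : Cell → Cell} {X Y Y₀ : ℤ} {V : Set Cell}

lemma flowX_ne_zero {x y : ℤ} (h : flowX d V x y ≠ 0) :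
    ∃ u ∈ V, u.2 = y ∧ (u.1 = x - 1 ∨ u.1 = x + 1) ∧ u + d u = (x, y) := by
  unfold flowX at h
  by_cases h1 : (x - 1, y) ∈ V ∧ d (x - 1, y) = (1, 0)
  · exact ⟨_, h1.1, rfl, Or.inl rfl, by rw [h1.2]; simp⟩
  · by_cases h2 : (x + 1, y) ∈ V ∧ d (x + 1, y) = (-1, 0)
    · exact ⟨_, h2.1, rfl, Or.inr rfl, by rw [h2.2]; simp⟩
    · simp [h1, h2] at h

lemma flowY_ne_zero {x y : ℤ} (h : flowY d V x y ≠ 0) :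
    ∃ u ∈ V, u.1 = x ∧ (u.2 = y - 1 ∨ u.2 = y + 1) ∧ u + d u = (x, y) := by
  unfold flowY at h
  by_cases h1 : (x, y - 1) ∈ V ∧ d (x, y - 1) = (0, 1)
  · exact ⟨_, h1.1, rfl, Or.inl rfl, by rw [h1.2]; simp⟩
  · by_cases h2 : (x, y + 1) ∈ V ∧ d (x, y + 1) = (0, -1)
    · exact ⟨_, h2.1, rfl, Or.inr rfl, by rw [h2.2]; simp⟩
    · simp [h1, h2] at h

lemma flowBelow_ne_zero {x y : ℤ} (h : flowBelow d V x y ≠ 0) :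
    ∃ u ∈ V, u.2 < y ∧ (u.1 = x - 1 ∨ u.1 = x + 1) ∧ (u + d u).1 = x ∧ (u + d u).2 < y := by
  obtain ⟨k, -, hk⟩ := Finset.exists_ne_zero_of_sum_ne_zero h
  obtain ⟨u, hu, h1, h2, h3⟩ := flowX_ne_zero hk
  refine ⟨u, hu, by omega, h2, by rw [h3], by rw [h3]; simp only; omega⟩

/-- A set of even squares of `Ω` on which gliding is a bijection, so that the flow of the steps
starting in it has neither sources nor sinks. -/
structure IsCurrent (Ω : Set Cell) (d : Cell → Cell) (V : Set Cell) : Prop where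
  subset : V ⊆ Ω
  even : ∀ c ∈ V, Even (c.1 + c.2)
  bijOn : BijOn (glide d) V V

namespace GlideSystem

lemma flowBelow_eq (G : GlideSystem Ω d X Y Y₀) (hV : V ⊆ Ω) {x y : ℤ} {N : ℕ} (hN : y.toNat ≤ N) :
    flowBelow d V x y = ∑ k ∈ Finset.range N, flowX d V x (y - 1 - 2 * k) := by
  refine Finset.sum_subset (by simpa using hN) fun k _ hk => ?_
  by_contra h
  obtain ⟨u, hu, h1, -⟩ := flowX_ne_zero h
  have := G.nonneg u (hV hu)
  simp at hk
  omega

lemma flowBelow_add_two (G : GlideSystem Ω d X Y Y₀) (hV : V ⊆ Ω) (x y : ℤ) :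
    flowBelow d V x (y + 2) = flowBelow d V x y + flowX d V x (y + 1) := by
  rw [G.flowBelow_eq hV (N := y.toNat + 2 + 1) (by omega),
    G.flowBelow_eq hV (N := y.toNat + 2) (by omega), Finset.sum_range_succ']
  congr 1
  · refine Finset.sum_congr rfl fun k _ => ?_
    congr 1; push_cast; ring
  · congr 1; push_cast; ring

open Classical in
/-- The flow of a current is conserved: at a square of `V` one step ends and one begins. -/
lemma flow_balance (G : GlideSystem Ω d X Y Y₀) (hV : IsCurrent Ω d V) (x y : ℤ) :
    flowX d V (x + 1) y - flowX d V (x - 1) y + flowY d V x (y + 1) - flowY d V x (y - 1) = 0 := by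
  have hout : (if (x, y) ∈ V ∧ d (x, y) = (1, 0) then 1 else 0) +
      (if (x, y) ∈ V ∧ d (x, y) = (-1, 0) then 1 else 0) +
      (if (x, y) ∈ V ∧ d (x, y) = (0, 1) then 1 else 0) +
      (if (x, y) ∈ V ∧ d (x, y) = (0, -1) then 1 else 0) = if (x, y) ∈ V then (1 : ℤ) else 0 := by
    by_cases h : (x, y) ∈ V
    · rcases G.isUnitVector _ (hV.subset h) (hV.even _ h) with h' | h' | h' | h' <;> simp [h, h']
    · simp [h]
  have hin : (if (x + 2, y) ∈ V ∧ d (x + 2, y) = (-1, 0) then 1 else 0) +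
      (if (x - 2, y) ∈ V ∧ d (x - 2, y) = (1, 0) then 1 else 0) +
      (if (x, y + 2) ∈ V ∧ d (x, y + 2) = (0, -1) then 1 else 0) +
      (if (x, y - 2) ∈ V ∧ d (x, y - 2) = (0, 1) then 1 else 0)
        = if (x, y) ∈ V then (1 : ℤ) else 0 := by
    have key : ∀ a b : ℤ, (x + 2 * a, y + 2 * b) ∈ V → d (x + 2 * a, y + 2 * b) = (-a, -b) →
        glide d (x + 2 * a, y + 2 * b) = (x, y) := by
      intro a b _ h
      simp only [glide, h, Prod.mk_add_mk, Prod.mk.injEq]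
      constructor <;> ring
    have k1 := key 1 0
    have k2 := key (-1) 0
    have k3 := key 0 1
    have k4 := key 0 (-1)
    simp only [mul_one, mul_zero, add_zero, mul_neg, neg_neg, neg_zero, ← sub_eq_add_neg] at k1 k2 k3 k4
    by_cases h : (x, y) ∈ V
    · obtain ⟨⟨a, b⟩, hu, hg⟩ := hV.bijOn.surjOn h
      have hinj : ∀ w ∈ V, glide d w = (x, y) → w = (a, b) := fun w hw hw' =>
        hV.bijOn.injOn hw hu (hw'.trans hg.symm)
      simp only [h, if_true]
      have hd := G.isUnitVector _ (hV.subset hu) (hV.even _ hu)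
      have e1 := fun p q => hinj _ p (k1 p q)
      have e2 := fun p q => hinj _ p (k2 p q)
      have e3 := fun p q => hinj _ p (k3 p q)
      have e4 := fun p q => hinj _ p (k4 p q)
      simp only [Prod.mk.injEq] at e1 e2 e3 e4
      have hx := glide_fst d (a, b)
      have hy := glide_snd d (a, b)
      rw [hg] at hx hy
      rcases hd with h' | h' | h' | h' <;> rw [h'] at hx hy <;> simp only at hx hy
      · have ha : a = x - 2 := by omega
        have hb : b = y := by omega
        subst ha hb
        rw [if_neg (fun h => by have := e1 h.1 h.2; omega), if_pos ⟨hu, h'⟩,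
          if_neg (fun h => by have := e3 h.1 h.2; omega),
          if_neg (fun h => by have := e4 h.1 h.2; omega)]
        norm_num
      · have ha : a = x + 2 := by omega
        have hb : b = y := by omega
        subst ha hb
        rw [if_pos ⟨hu, h'⟩, if_neg (fun h => by have := e2 h.1 h.2; omega),
          if_neg (fun h => by have := e3 h.1 h.2; omega),
          if_neg (fun h => by have := e4 h.1 h.2; omega)]
        norm_num
      · have ha : a = x := by omega
        have hb : b = y - 2 := by omega
        subst ha hb
        rw [if_neg (fun h => by have := e1 h.1 h.2; omega),
          if_neg (fun h => by have := e2 h.1 h.2; omega),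
          if_neg (fun h => by have := e3 h.1 h.2; omega), if_pos ⟨hu, h'⟩]
        norm_num
      · have ha : a = x := by omega
        have hb : b = y + 2 := by omega
        subst ha hb
        rw [if_neg (fun h => by have := e1 h.1 h.2; omega),
          if_neg (fun h => by have := e2 h.1 h.2; omega), if_pos ⟨hu, h'⟩,
          if_neg (fun h => by have := e4 h.1 h.2; omega)]
        norm_num
    · have hno : ∀ w ∈ V, glide d w ≠ (x, y) := fun w hw hw' => h (hw' ▸ hV.bijOn.mapsTo hw)
      rw [if_neg (fun h => hno _ h.1 (k1 h.1 h.2)), if_neg (fun h => hno _ h.1 (k2 h.1 h.2)),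
        if_neg (fun h => hno _ h.1 (k3 h.1 h.2)), if_neg (fun h => hno _ h.1 (k4 h.1 h.2)), if_neg h]
      norm_num
  simp only [flowX, flowY, add_sub_cancel_right, sub_add_cancel, sub_sub, add_assoc] at hin hout ⊢
  norm_num only at hin hout ⊢
  linarith

/-- Moving the ray two columns to the right changes the flow across it only by the vertical flow
through its end, by conservation of the flow in the column between the two rays. -/
lemma flowBelow_add_two_right (G : GlideSystem Ω d X Y Y₀) (hV : IsCurrent Ω d V) (x y : ℤ) :
    flowBelow d V (x + 2) y = flowBelow d V x y - flowY d V (x + 1) y := by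
  have h0 : flowY d V (x + 1) (y - 2 * (y.toNat + 1 : ℕ)) = 0 := by
    by_contra h
    obtain ⟨u, hu, -, h1, -⟩ := flowY_ne_zero h
    have := G.nonneg u (hV.subset hu)
    push_cast at h1
    omega
  have htel := Finset.sum_range_sub (fun k : ℕ => flowY d V (x + 1) (y - 2 * k)) (y.toNat + 1)
  rw [G.flowBelow_eq hV.subset (N := y.toNat + 1) (by omega),
    G.flowBelow_eq hV.subset (N := y.toNat + 1) (by omega), ← sub_eq_zero]
  simp only [h0, Nat.cast_zero, mul_zero, sub_zero, zero_sub] at htel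
  rw [← sub_add, ← Finset.sum_sub_distrib, ← neg_neg (flowY d V (x + 1) y), ← htel,
    ← sub_eq_add_neg, ← Finset.sum_sub_distrib]
  refine Finset.sum_eq_zero fun k _ => ?_
  have hb := G.flow_balance hV (x + 1) (y - 1 - 2 * k)
  have e1 : y - 2 * ((k + 1 : ℕ) : ℤ) = y - 1 - 2 * k - 1 := by push_cast; ring
  have e2 : y - 2 * (k : ℤ) = y - 1 - 2 * k + 1 := by ring
  rw [e1, e2]
  rw [show x + 1 + 1 = x + 2 by ring, show x + 1 - 1 = x by ring] at hb
  linarith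

/-- The height function is invariant under gliding: a step starting outside `V` crosses no step
starting in `V`, since the odd square in its middle is matched only once. -/
lemma flowBelow_glide (G : GlideSystem Ω d X Y Y₀) (hV : IsCurrent Ω d V) {f : Cell} (hf : f ∈ Ω)
    (he : Even (f.1 + f.2)) (hfV : f ∉ V) :
    flowBelow d V (glide d f).1 (glide d f).2 = flowBelow d V f.1 f.2 := by
  have hX : flowX d V (f + d f).1 (f + d f).2 = 0 := by
    by_contra h
    obtain ⟨u, hu, -, -, h1⟩ := flowX_ne_zero h
    exact hfV (G.inj u (hV.subset hu) f hf (hV.even u hu) he h1 ▸ hu)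
  have hY : flowY d V (f + d f).1 (f + d f).2 = 0 := by
    by_contra h
    obtain ⟨u, hu, -, -, h1⟩ := flowY_ne_zero h
    exact hfV (G.inj u (hV.subset hu) f hf (hV.even u hu) he h1 ▸ hu)
  obtain ⟨x, y⟩ := f
  rw [glide_fst, glide_snd]
  rcases G.isUnitVector _ hf he with h | h | h | h <;> rw [h] at hX hY ⊢ <;>
    simp only [Prod.mk_add_mk, add_zero, mul_one, mul_zero, mul_neg] at hX hY ⊢
  · rw [G.flowBelow_add_two_right hV, hY, sub_zero]
  · have := G.flowBelow_add_two_right hV (x + -2) y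
    rw [neg_add_cancel_right, show x + -2 + 1 = x + -1 by ring, hY, sub_zero] at this
    exact this.symm
  · rw [G.flowBelow_add_two hV.subset, hX, add_zero]
  · have := G.flowBelow_add_two hV.subset x (y + -2)
    rw [neg_add_cancel_right, show y + -2 + 1 = y + -1 by ring, hX, add_zero] at this
    exact this.symm

/-- Squares outside `Ω` are not enclosed by a current, since `Ω` is closed under going up. -/
lemma mem_of_flowBelow_ne_zero (G : GlideSystem Ω d X Y Y₀) (hV : IsCurrent Ω d V) {x y : ℤ}
    (h : flowBelow d V x y ≠ 0) : (x, y) ∈ Ω := by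
  obtain ⟨u, hu, -, -, h1, h2⟩ := flowBelow_ne_zero h
  refine G.up x _ y ?_ h2.le
  rw [← h1]
  exact G.add_mem u (hV.subset hu) (hV.even u hu)

/-- A path that starts at a square enclosed by a current stays enclosed. In particular it does not
leave `Ω`, which therefore is not a hypothesis. -/
lemma flowBelow_iterate_of_ne_zero (G : GlideSystem Ω d X Y Y₀) (hV : IsCurrent Ω d V) {f : Cell}
    (he : Even (f.1 + f.2)) (hfV : ∀ k, (glide d)^[k] f ∉ V) (h : flowBelow d V f.1 f.2 ≠ 0)
    (k : ℕ) : flowBelow d V ((glide d)^[k] f).1 ((glide d)^[k] f).2 = flowBelow d V f.1 f.2 := by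
  induction k with
  | zero => rfl
  | succ k ih =>
    rw [Function.iterate_succ_apply', G.flowBelow_glide hV _ (even_iterate he k) (hfV k), ih]
    exact G.mem_of_flowBelow_ne_zero hV (by rwa [ih])

/-! ### Gliding paths have no cycles -/

lemma iterate_left (G : GlideSystem Ω d X Y Y₀) {c : Cell} (he : Even (c.1 + c.2))
    (hΩ : ∀ k, (glide d)^[k] c ∈ Ω) (h : c.1 ≤ -X ∨ Y ≤ c.2) (k : ℕ) :
    (glide d)^[k] c = (c.1 - 2 * k, c.2) := by
  induction k with
  | zero => simp
  | succ k ih =>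
    have := G.left _ (hΩ k) (even_iterate he k) (by rw [ih]; simp only; omega)
    rw [Function.iterate_succ_apply', glide, this, ih]
    simp; ring

lemma iterate_fst_le (G : GlideSystem Ω d X Y Y₀) {c : Cell} (he : Even (c.1 + c.2))
    (hΩ : ∀ k, (glide d)^[k] c ∈ Ω) (k : ℕ) : ((glide d)^[k] c).1 ≤ max c.1 (X + 2) := by
  induction k with
  | zero => simp
  | succ k ih =>
    rw [Function.iterate_succ_apply', glide_fst]
    by_cases h : X ≤ ((glide d)^[k] c).1
    · rw [G.left _ (hΩ k) (even_iterate he k) (Or.inr (Or.inl h))]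
      simp only; omega
    · rcases G.isUnitVector _ (hΩ k) (even_iterate he k) with h' | h' | h' | h' <;> rw [h'] <;>
        simp only <;> omega

lemma eventually_left_of_le (G : GlideSystem Ω d X Y Y₀) {c : Cell} (he : Even (c.1 + c.2))
    (hΩ : ∀ k, (glide d)^[k] c ∈ Ω) {k : ℕ} (hk : Y ≤ ((glide d)^[k] c).2) :
    ∃ k, ((glide d)^[k] c).1 < -X := by
  have := G.iterate_left (even_iterate he k) (fun j => by
    rw [← Function.iterate_add_apply]; exact hΩ _) (Or.inr hk)
      ((((glide d)^[k] c).1 + X).toNat + 1)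
  rw [← Function.iterate_add_apply] at this
  refine ⟨_, by rw [this]; simp only; push_cast; omega⟩

/-- A path which does not escape to the left stays in a bounded box, hence becomes periodic. -/
lemma exists_iterate_eq (G : GlideSystem Ω d X Y Y₀) {c : Cell} (he : Even (c.1 + c.2))
    (hΩ : ∀ k, (glide d)^[k] c ∈ Ω) (h : ∀ k, -X ≤ ((glide d)^[k] c).1) :
    ∃ i p, 0 < p ∧ (glide d)^[p] ((glide d)^[i] c) = (glide d)^[i] c := by
  have hY : ∀ k, ((glide d)^[k] c).2 < Y := by
    intro k
    by_contra hk
    obtain ⟨j, hj⟩ := G.eventually_left_of_le he hΩ (not_lt.1 hk)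
    exact absurd (h j) (not_le.2 hj)
  have hfin : (Icc (-X) (max c.1 (X + 2)) ×ˢ Icc 0 Y).Finite := (finite_Icc _ _).prod (finite_Icc _ _)
  have hmaps : MapsTo (fun k : ℕ => (glide d)^[k] c) univ
      (Icc (-X) (max c.1 (X + 2)) ×ˢ Icc 0 Y) := fun k _ =>
    ⟨⟨h k, G.iterate_fst_le he hΩ k⟩, ⟨G.nonneg _ (hΩ k), (hY k).le⟩⟩
  obtain ⟨i, -, j, -, hij, heq⟩ := infinite_univ.exists_ne_map_eq_of_mapsTo hmaps hfin
  rcases lt_or_gt_of_ne hij with hij | hij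
  · refine ⟨i, j - i, by omega, ?_⟩
    rw [← Function.iterate_add_apply, heq]; congr 2; omega
  · refine ⟨j, i - j, by omega, ?_⟩
    rw [← Function.iterate_add_apply, ← heq]; congr 2; omega

lemma isCurrent_of_periodic {Ω : Set Cell} {c : Cell} (he : Even (c.1 + c.2))
    (hΩ : ∀ k, (glide d)^[k] c ∈ Ω) {p : ℕ} (hp : 0 < p) (hc : (glide d)^[p] c = c) :
    IsCurrent Ω d (range fun k => (glide d)^[k] c) where
  subset := by rintro _ ⟨k, rfl⟩; exact hΩ k
  even := by rintro _ ⟨k, rfl⟩; exact even_iterate he k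
  bijOn := by
    have hper : ∀ k, (glide d)^[p] ((glide d)^[k] c) = (glide d)^[k] c := by
      intro k
      rw [← Function.iterate_add_apply, add_comm, Function.iterate_add_apply, hc]
    have hper' : ∀ k, (glide d)^[p - 1] (glide d ((glide d)^[k] c)) = (glide d)^[k] c := by
      intro k
      rw [← Function.iterate_succ_apply, Nat.succ_eq_add_one, Nat.sub_add_cancel hp, hper]
    refine ⟨?_, ?_, ?_⟩
    · rintro _ ⟨k, rfl⟩
      exact ⟨k + 1, Function.iterate_succ_apply' _ _ _⟩
    · rintro _ ⟨a, rfl⟩ _ ⟨b, rfl⟩ hab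
      dsimp only
      rw [← hper' a, ← hper' b, hab]
    · rintro _ ⟨k, rfl⟩
      refine ⟨_, ⟨p - 1 + k, rfl⟩, ?_⟩
      dsimp only
      rw [← Function.iterate_succ_apply' (glide d), ← Nat.succ_add, Nat.succ_eq_add_one,
        Nat.sub_add_cancel hp, Function.iterate_add_apply, hper]

open Classical in
/-- The heights of the two squares on either side of a step of a current differ, so one of them is
nonzero. -/
lemma exists_flowBelow_ne_zero (G : GlideSystem Ω d X Y Y₀) (hV : IsCurrent Ω d V) {v : Cell}
    (hv : v ∈ V) : ∃ f : Cell, Even (f.1 + f.2) ∧ (Even f.2 ↔ ¬ Even v.2) ∧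
      flowBelow d V f.1 f.2 ≠ 0 := by
  by_contra! hcon
  have he := hV.even v hv
  have huniq : ∀ u ∈ V, u + d u = v + d v → u = v := fun u hu h =>
    G.inj u (hV.subset hu) v (hV.subset hv) (hV.even u hu) he h
  obtain ⟨x, y⟩ := v
  simp only at he hcon
  have h1 := hcon (x + 1, y + 1) (by simp only; grind) (by simp only; grind)
  have h2 := hcon (x + 1, y - 1) (by simp only; grind) (by simp only; grind)
  have h3 := hcon (x - 1, y + 1) (by simp only; grind) (by simp only; grind)
  have h4 := hcon (x - 1, y - 1) (by simp only; grind) (by simp only; grind)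
  simp only at h1 h2 h3 h4
  have e1 := G.flowBelow_add_two hV.subset (x + 1) (y - 1)
  have e2 := G.flowBelow_add_two hV.subset (x - 1) (y - 1)
  have e3 := G.flowBelow_add_two_right hV (x - 1) (y + 1)
  have e4 := G.flowBelow_add_two_right hV (x - 1) (y - 1)
  rw [show y - 1 + 2 = y + 1 by ring, sub_add_cancel, h1, h2] at e1
  rw [show y - 1 + 2 = y + 1 by ring, sub_add_cancel, h3, h4] at e2
  rw [show x - 1 + 2 = x + 1 by ring, sub_add_cancel, h1, h3] at e3
  rw [show x - 1 + 2 = x + 1 by ring, sub_add_cancel, h2, h4] at e4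
  simp only [flowX, flowY, add_sub_cancel_right, sub_add_cancel, add_assoc, sub_sub] at e1 e2 e3 e4
  norm_num only at e1 e2 e3 e4
  rcases G.isUnitVector _ (hV.subset hv) he with h | h | h | h
  · have : ¬ ((x + 2, y) ∈ V ∧ d (x + 2, y) = (-1, 0)) := fun h' => by
      have := huniq _ h'.1 (by rw [h, h'.2]; ext <;> simp; ring)
      simp at this
    simp [this, hv, h] at e1
  · have : ¬ ((x - 2, y) ∈ V ∧ d (x - 2, y) = (1, 0)) := fun h' => by
      have := huniq _ h'.1 (by rw [h, h'.2]; ext <;> simp; ring)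
      simp at this
    simp [this, hv, h] at e2
  · have : ¬ ((x, y + 2) ∈ V ∧ d (x, y + 2) = (0, -1)) := fun h' => by
      have := huniq _ h'.1 (by rw [h, h'.2]; ext <;> simp; ring)
      simp at this
    simp [this, hv, h] at e3
  · have : ¬ ((x, y - 2) ∈ V ∧ d (x, y - 2) = (0, 1)) := fun h' => by
      have := huniq _ h'.1 (by rw [h, h'.2]; ext <;> simp; ring)
      simp at this
    simp [this, hv, h] at e4

/-- There are no cycles. A cycle encloses some square of the other kind, whose path is trapped and
therefore runs into a cycle; all squares of that cycle are above the lowest square of the first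
one. Hence there would be cycles above any given height. -/
lemma iterate_ne_self (G : GlideSystem Ω d X Y Y₀) {c : Cell} (he : Even (c.1 + c.2))
    (hΩ : ∀ k, (glide d)^[k] c ∈ Ω) {p : ℕ} (hp : 0 < p) : (glide d)^[p] c ≠ c := by
  intro hc
  have hleft : ∀ (c : Cell), Even (c.1 + c.2) → (∀ k, (glide d)^[k] c ∈ Ω) → ∀ p, 0 < p →
      (glide d)^[p] c = c → -X < c.1 ∧ c.2 < Y := by
    intro c he hΩ p hp hc
    by_contra h
    have := G.iterate_left he hΩ (by omega) p
    rw [hc] at this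
    have := congrArg Prod.fst this
    simp only at this
    omega
  have main : ∀ m : ℕ, ∃ c : Cell, Even (c.1 + c.2) ∧ (∀ k, (glide d)^[k] c ∈ Ω) ∧
      (∃ p, 0 < p ∧ (glide d)^[p] c = c) ∧ ∀ k, (m : ℤ) ≤ ((glide d)^[k] c).2 := by
    intro m
    induction m with
    | zero => exact ⟨c, he, hΩ, ⟨p, hp, hc⟩, fun k => by simpa using G.nonneg _ (hΩ k)⟩
    | succ m ih =>
      obtain ⟨c, he, hΩ, ⟨p, hp, hc⟩, hm⟩ := ih
      have hV := isCurrent_of_periodic he hΩ hp hc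
      obtain ⟨f, hfe, hpar, hf⟩ := G.exists_flowBelow_ne_zero hV ⟨0, rfl⟩
      have hfV : ∀ k, (glide d)^[k] f ∉ range fun k => (glide d)^[k] c := by
        rintro k ⟨j, hj⟩
        have h1 := even_iterate_snd d f k
        rw [← hj] at h1
        have h2 := even_iterate_snd d c j
        simp only [Function.iterate_zero, id_eq] at h1 h2 hpar
        tauto
      have htrap := fun k => (G.flowBelow_iterate_of_ne_zero hV hfe hfV hf k).trans_ne hf
      have hfΩ := fun k => G.mem_of_flowBelow_ne_zero hV (htrap k)
      obtain ⟨i, q, hq, hqi⟩ := G.exists_iterate_eq hfe hfΩ fun k => by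
        obtain ⟨_, ⟨j, rfl⟩, -, h1, -⟩ := flowBelow_ne_zero (htrap k)
        have := (hleft _ (even_iterate he j) (fun k => by
          rw [← Function.iterate_add_apply]; exact hΩ _) p hp (by
          rw [← Function.iterate_add_apply, add_comm, Function.iterate_add_apply, hc])).1
        simp only at h1
        omega
      refine ⟨_, even_iterate hfe i, fun k => ?_, ⟨q, hq, hqi⟩, fun k => ?_⟩
      · rw [← Function.iterate_add_apply]; exact hfΩ _
      · rw [← Function.iterate_add_apply]
        obtain ⟨_, ⟨j, rfl⟩, h1, -⟩ := flowBelow_ne_zero (htrap (k + i))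
        have := hm j
        simp only at h1
        push_cast
        omega
  obtain ⟨c, he, hΩ, ⟨p, hp, hc⟩, hm⟩ := main Y.toNat
  have h1 := (hleft c he hΩ p hp hc).2
  have h2 := hm 0
  simp only [Function.iterate_zero, id_eq] at h2
  omega

end GlideSystem

/-! ### Incoming paths -/

/-- The squares visited by the gliding paths which come in from the far right on row `y`. -/
def incoming (d : Cell → Cell) (X y : ℤ) : Set Cell :=
  {c | ∃ x k, X ≤ x ∧ Even (x + y) ∧ (glide d)^[k] (x, y) = c}

lemma even_of_mem_incoming {y : ℤ} {c : Cell} (hc : c ∈ incoming d X y) : Even (c.1 + c.2) := by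
  obtain ⟨x, k, -, h, rfl⟩ := hc
  exact even_iterate h k

lemma even_snd_of_mem_incoming {y : ℤ} {c : Cell} (hc : c ∈ incoming d X y) :
    Even c.2 ↔ Even y := by
  obtain ⟨x, k, -, h, rfl⟩ := hc
  exact even_iterate_snd d _ k

lemma iterate_mem_incoming {y : ℤ} {c : Cell} (hc : c ∈ incoming d X y) (j : ℕ) :
    (glide d)^[j] c ∈ incoming d X y := by
  obtain ⟨x, k, hx, h, rfl⟩ := hc
  exact ⟨x, j + k, hx, h, Function.iterate_add_apply _ _ _ _⟩

lemma glide_mem_incoming {y : ℤ} {c : Cell} (hc : c ∈ incoming d X y) :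
    glide d c ∈ incoming d X y :=
  iterate_mem_incoming hc 1

/-- The height function in a column that is crossed only on row `y`, from right to left. -/
lemma flowBelow_eq_ite {x y z : ℤ} (hy : 0 ≤ y) (hyz : Even z ↔ ¬ Even y)
    (h : ∀ t, (Even t ↔ Even y) → flowX d V x t = if t = y then -1 else 0) :
    flowBelow d V x z = if y < z then -1 else 0 := by
  unfold flowBelow
  have hsum : ∀ k ∈ Finset.range z.toNat, flowX d V x (z - 1 - 2 * (k : ℤ)) =
      if z - 1 - 2 * (k : ℤ) = y then -1 else 0 := fun k _ => h _ (by grind)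
  rw [Finset.sum_congr rfl hsum]
  split_ifs with hlt
  · have : ∃ m : ℕ, z - 1 - 2 * m = y := by
      obtain ⟨m, hm⟩ : Even (z - 1 - y) := by grind
      exact ⟨m.toNat, by omega⟩
    obtain ⟨m, hm⟩ := this
    rw [Finset.sum_eq_single m, if_pos hm]
    · intro k _ hk
      rw [if_neg]; omega
    · intro hk
      simp at hk
      omega
  · refine Finset.sum_eq_zero fun k _ => ?_
    rw [if_neg]; omega

namespace GlideSystem

lemma flowBelow_iterate (G : GlideSystem Ω d X Y Y₀) (hV : IsCurrent Ω d V) {f : Cell}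
    (he : Even (f.1 + f.2)) (hfΩ : ∀ k, (glide d)^[k] f ∈ Ω) (hfV : ∀ k, (glide d)^[k] f ∉ V)
    (k : ℕ) : flowBelow d V ((glide d)^[k] f).1 ((glide d)^[k] f).2 = flowBelow d V f.1 f.2 := by
  induction k with
  | zero => rfl
  | succ k ih =>
    rw [Function.iterate_succ_apply', G.flowBelow_glide hV (hfΩ k) (even_iterate he k) (hfV k), ih]

lemma glide_right (G : GlideSystem Ω d X Y Y₀) {x y : ℤ} (hy : Y₀ ≤ y) (hx : X ≤ x)
    (he : Even (x + y)) : glide d (x, y) = (x - 2, y) := by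
  rw [glide, G.left (x, y) (G.top x y hy) he (Or.inr (Or.inl hx))]
  simp; ring

lemma iterate_right (G : GlideSystem Ω d X Y Y₀) {x y : ℤ} (hy : Y₀ ≤ y) (hx : X ≤ x)
    (he : Even (x + y)) (m : ℕ) : (glide d)^[m] (x + 2 * m, y) = (x, y) := by
  induction m with
  | zero => simp
  | succ m ih =>
    rw [Function.iterate_succ_apply, G.glide_right hy (by omega) (by push_cast; grind), ← ih]
    congr 2; push_cast; ring

lemma exists_common_start (G : GlideSystem Ω d X Y Y₀) {y : ℤ} (hy : Y₀ ≤ y) {c c' : Cell}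
    (hc : c ∈ incoming d X y) (hc' : c' ∈ incoming d X y) :
    ∃ x k k', X ≤ x ∧ Even (x + y) ∧ (glide d)^[k] (x, y) = c ∧ (glide d)^[k'] (x, y) = c' := by
  obtain ⟨x, k, hx, he, rfl⟩ := hc
  obtain ⟨x', k', hx', he', rfl⟩ := hc'
  rcases le_total x x' with h | h
  · obtain ⟨m, rfl⟩ : ∃ m : ℕ, x' = x + 2 * m := by
      obtain ⟨m, hm⟩ : Even (x' - x) := by grind
      exact ⟨m.toNat, by omega⟩
    refine ⟨x + 2 * m, k + m, k', hx', he', ?_, rfl⟩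
    rw [Function.iterate_add_apply, G.iterate_right hy hx he]
  · obtain ⟨m, rfl⟩ : ∃ m : ℕ, x = x' + 2 * m := by
      obtain ⟨m, hm⟩ : Even (x - x') := by grind
      exact ⟨m.toNat, by omega⟩
    refine ⟨x' + 2 * m, k, k' + m, hx, he, rfl, ?_⟩
    rw [Function.iterate_add_apply, G.iterate_right hy hx' he']

lemma exists_start_gt (G : GlideSystem Ω d X Y Y₀) {y : ℤ} (hy : Y₀ ≤ y) {c : Cell}
    (hc : c ∈ incoming d X y) : ∃ x k, X < x ∧ Even (x + y) ∧ (glide d)^[k] (x, y) = c := by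
  obtain ⟨x, k, hx, he, rfl⟩ := hc
  refine ⟨x + 2 * (1 : ℕ), k + 1, by push_cast; omega, by push_cast; grind, ?_⟩
  rw [Function.iterate_add_apply, G.iterate_right hy hx he]

lemma isCurrent_incoming (G : GlideSystem Ω d X Y Y₀) {y : ℤ} (hy : Y₀ ≤ y)
    (hsub : incoming d X y ⊆ Ω) : IsCurrent Ω d (incoming d X y) where
  subset := hsub
  even c hc := even_of_mem_incoming hc
  bijOn := by
    refine ⟨fun c hc => glide_mem_incoming hc, fun c hc c' hc' h => ?_, fun c hc => ?_⟩
    · obtain ⟨x, k, k', hx, he, rfl, rfl⟩ := G.exists_common_start hy hc hc'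
      rw [← Function.iterate_succ_apply' (glide d), ← Function.iterate_succ_apply' (glide d)] at h
      have key : ∀ i j, i < j → (glide d)^[i] (x, y) ≠ (glide d)^[j] (x, y) := by
        intro i j hij h
        obtain ⟨p, rfl⟩ := Nat.exists_eq_add_of_lt hij
        refine G.iterate_ne_self (c := (glide d)^[i] (x, y)) (even_iterate he i)
          (fun m => hsub ⟨x, m + i, hx, he, Function.iterate_add_apply _ _ _ _⟩)
          (Nat.succ_pos p) ?_
        rw [← Function.iterate_add_apply, h]
        congr 1
        omega
      rcases lt_trichotomy k k' with hlt | rfl | hlt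
      · exact absurd h (key _ _ (by omega))
      · rfl
      · exact absurd h.symm (key _ _ (by omega))
    · obtain ⟨x, k, hx, he, rfl⟩ := hc
      cases k with
      | zero =>
        refine ⟨(x + 2, y), ⟨x + 2, 0, by omega, by grind, rfl⟩, ?_⟩
        rw [G.glide_right hy (by omega) (by grind)]
        simp
      | succ k => exact ⟨_, ⟨x, k, hx, he, rfl⟩, (Function.iterate_succ_apply' _ _ _).symm⟩

/-- A path which is on the far right is still on its initial row. -/
lemma snd_eq_of_right (G : GlideSystem Ω d X Y Y₀) {y : ℤ}
    (hsub : incoming d X y ⊆ Ω) {c : Cell} (hc : c ∈ incoming d X y) (hcX : X ≤ c.1) :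
    c.2 = y := by
  obtain ⟨x, k, hx, he, rfl⟩ := hc
  induction k with
  | zero => rfl
  | succ k ih =>
    have hu : (glide d)^[k] (x, y) ∈ Ω := hsub ⟨x, k, hx, he, rfl⟩
    have hv : (glide d)^[k + 1] (x, y) ∈ Ω := hsub ⟨x, k + 1, hx, he, rfl⟩
    have hue := even_iterate (d := d) (c := (x, y)) he k
    have hve := even_iterate (d := d) (c := (x, y)) he (k + 1)
    have hdv := G.left _ hv hve (Or.inr (Or.inl hcX))
    rw [Function.iterate_succ_apply'] at hcX hv hve hdv ⊢
    set u := (glide d)^[k] (x, y)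
    have hX : X ≤ u.1 := by
      rcases G.isUnitVector u hu hue with h | h | h | h
      -- a step to the right would end at a square matched with the same odd square as `u`
      · have := congrArg Prod.fst (G.inj u hu _ hv hue hve (by
          rw [hdv, glide, h]; ext <;> simp))
        rw [glide_fst, h] at this
        simp at this
      all_goals
        rw [glide_fst, h] at hcX
        simp only at hcX
        omega
    rw [glide_snd, G.left u hu hue (Or.inr (Or.inl hX)), ih hX]
    simp

lemma flowBelow_right (G : GlideSystem Ω d X Y Y₀) {y : ℤ} (hy : Y₀ ≤ y)
    (hsub : incoming d X y ⊆ Ω) {x z : ℤ} (hx : X < x) (hxz : Even (x + z))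
    (hyz : Even z ↔ ¬ Even y) :
    flowBelow d (incoming d X y) x z = if y < z then -1 else 0 := by
  refine flowBelow_eq_ite (G.nonneg _ (G.top 0 y hy)) hyz fun t ht => ?_
  have h1 : ¬ ((x - 1, t) ∈ incoming d X y ∧ d (x - 1, t) = (1, 0)) := fun h => by
    have := h.2.symm.trans (G.left _ (hsub h.1) (even_of_mem_incoming h.1)
      (Or.inr (Or.inl (by simp only; omega))))
    simp at this
  have h2 : ((x + 1, t) ∈ incoming d X y ∧ d (x + 1, t) = (-1, 0)) ↔ t = y := by
    constructor
    · intro h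
      exact G.snd_eq_of_right hsub h.1 (by simp only; omega)
    · rintro rfl
      have : (x + 1, t) ∈ incoming d X t := ⟨x + 1, 0, by omega, by grind, rfl⟩
      exact ⟨this, G.left _ (hsub this) (even_of_mem_incoming this)
        (Or.inr (Or.inl (by simp only; omega)))⟩
  simp only [flowX, h1, h2, if_false]
  split_ifs <;> rfl

/-- Incoming paths do not leave `Ω`: the paths on odd rows are enclosed by the one on row `Y₀`. -/
lemma incoming_subset (G : GlideSystem Ω d X Y Y₀) {y : ℤ} (hy : Y₀ ≤ y) :
    incoming d X y ⊆ Ω := by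
  have heven : ∀ y, Y₀ ≤ y → Even y → incoming d X y ⊆ Ω := by
    rintro y hy hye _ ⟨x, k, hx, he, rfl⟩
    induction k with
    | zero => exact G.top x y hy
    | succ k ih =>
      rw [Function.iterate_succ_apply']
      have h1 := (even_iterate_snd d (x, y) k).2 hye
      have h2 := even_iterate (d := d) (c := (x, y)) he k
      exact G.glide_mem _ ih (by grind) h1
  by_cases hye : Even y
  · exact heven y hy hye
  · intro c hc
    have hsub := heven Y₀ le_rfl G.even_bottom
    have hV := G.isCurrent_incoming le_rfl hsub
    obtain ⟨x, k, hx, he, rfl⟩ := G.exists_start_gt hy hc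
    have hne : flowBelow d (incoming d X Y₀) x y ≠ 0 := by
      rw [G.flowBelow_right le_rfl hsub hx he (by have := G.even_bottom; tauto), if_pos]
      · norm_num
      · refine lt_of_le_of_ne hy ?_
        rintro rfl
        exact hye G.even_bottom
    refine G.mem_of_flowBelow_ne_zero hV
      ((G.flowBelow_iterate_of_ne_zero hV (f := (x, y)) he (fun j hj => ?_) hne k).trans_ne hne)
    have h1 := even_snd_of_mem_incoming hj
    have h2 := even_iterate_snd d (x, y) j
    have := G.even_bottom
    tauto

lemma iterate_mem_of_mem_incoming (G : GlideSystem Ω d X Y Y₀) {y : ℤ} (hy : Y₀ ≤ y) {c : Cell}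
    (hc : c ∈ incoming d X y) (k : ℕ) : (glide d)^[k] c ∈ Ω :=
  G.incoming_subset hy (iterate_mem_incoming hc k)

lemma exists_iterate_left (G : GlideSystem Ω d X Y Y₀) {y : ℤ} (hy : Y₀ ≤ y) {c : Cell}
    (hc : c ∈ incoming d X y) : ∃ k, ((glide d)^[k] c).1 < -X := by
  by_contra! h
  obtain ⟨i, p, hp, hpi⟩ := G.exists_iterate_eq (even_of_mem_incoming hc)
    (G.iterate_mem_of_mem_incoming hy hc) h
  exact G.iterate_ne_self (even_iterate (even_of_mem_incoming hc) i)
    (G.iterate_mem_of_mem_incoming hy (iterate_mem_incoming hc i)) hp hpi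

lemma exists_mem_incoming_left (G : GlideSystem Ω d X Y Y₀) {y : ℤ} (hy : Y₀ ≤ y) :
    ∃ c ∈ incoming d X y, c.1 < -X := by
  obtain ⟨x, hx, he⟩ : ∃ x, X ≤ x ∧ Even (x + y) := by
    by_cases h : Even (X + y)
    · exact ⟨X, le_rfl, h⟩
    · exact ⟨X + 1, by omega, by grind⟩
  have hmem : (x, y) ∈ incoming d X y := ⟨x, 0, hx, he, rfl⟩
  obtain ⟨k, hk⟩ := G.exists_iterate_left hy hmem
  exact ⟨_, iterate_mem_incoming hmem k, hk⟩

lemma snd_eq_snd_of_left (G : GlideSystem Ω d X Y Y₀) {y : ℤ} (hy : Y₀ ≤ y) {c c' : Cell}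
    (hc : c ∈ incoming d X y) (hc' : c' ∈ incoming d X y) (hcX : c.1 < -X) (hcX' : c'.1 < -X) :
    c.2 = c'.2 := by
  have key : ∀ (s : Cell) (k m : ℕ), (glide d)^[k] s ∈ incoming d X y →
      ((glide d)^[k] s).1 < -X → ((glide d)^[k] s).2 = ((glide d)^[k + m] s).2 := by
    intro s k m hs hX
    rw [add_comm k, Function.iterate_add_apply, G.iterate_left (even_of_mem_incoming hs)
      (G.iterate_mem_of_mem_incoming hy hs) (Or.inl hX.le)]
  obtain ⟨x, k, k', hx, he, rfl, rfl⟩ := G.exists_common_start hy hc hc'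
  rcases le_total k k' with h | h <;> obtain ⟨m, rfl⟩ := Nat.exists_eq_add_of_le h
  · exact key _ _ _ hc hcX
  · exact (key _ _ _ hc' hcX').symm

lemma flowBelow_left (G : GlideSystem Ω d X Y Y₀) {y : ℤ} (hy : Y₀ ≤ y) {c : Cell}
    (hc : c ∈ incoming d X y) (hcX : c.1 < -X) {x z : ℤ} (hx : x < c.1) (hxz : Even (x + z))
    (hyz : Even z ↔ ¬ Even y) :
    flowBelow d (incoming d X y) x z = if c.2 < z then -1 else 0 := by
  have hsub := G.incoming_subset hy
  have hpar := even_snd_of_mem_incoming hc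
  have hce := even_of_mem_incoming hc
  refine flowBelow_eq_ite (G.nonneg _ (hsub hc)) (by tauto) fun t ht => ?_
  have h1 : ¬ ((x - 1, t) ∈ incoming d X y ∧ d (x - 1, t) = (1, 0)) := fun h => by
    have := h.2.symm.trans (G.left _ (hsub h.1) (even_of_mem_incoming h.1)
      (Or.inl (by simp only; omega)))
    simp at this
  have h2 : ((x + 1, t) ∈ incoming d X y ∧ d (x + 1, t) = (-1, 0)) ↔ t = c.2 := by
    constructor
    · intro h
      exact G.snd_eq_snd_of_left hy h.1 hc (by simp only; omega) hcX
    · rintro rfl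
      have : (x + 1, c.2) ∈ incoming d X y := by
        obtain ⟨m, hm⟩ : Even (c.1 - (x + 1)) := by grind
        have := iterate_mem_incoming hc m.toNat
        rw [G.iterate_left hce (G.iterate_mem_of_mem_incoming hy hc) (Or.inl hcX.le)] at this
        convert this using 2
        omega
      exact ⟨this, G.left _ (hsub this) (even_of_mem_incoming this)
        (Or.inl (by simp only; omega))⟩
  simp only [flowX, h1, h2, if_false]
  split_ifs <;> rfl

/-- Two incoming paths of different kinds keep their vertical order: compare the values of the height
function of the first one at both ends of the second one. -/
lemma lt_iff_lt (G : GlideSystem Ω d X Y Y₀) {y y' : ℤ} (hy : Y₀ ≤ y) (hy' : Y₀ ≤ y')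
    (hyy' : Even y' ↔ ¬ Even y) {c c' : Cell} (hc : c ∈ incoming d X y)
    (hc' : c' ∈ incoming d X y') (hcX : c.1 < -X) (hcX' : c'.1 < -X) :
    y < y' ↔ c.2 < c'.2 := by
  have hV := G.isCurrent_incoming hy (G.incoming_subset hy)
  obtain ⟨x, k, hx, he, hk⟩ := G.exists_start_gt hy' hc'
  have hs : (x, y') ∈ incoming d X y' := ⟨x, 0, hx.le, he, rfl⟩
  have hpar := even_snd_of_mem_incoming hc'
  -- a cell of the second path to the left of `c`
  obtain ⟨m, hm⟩ : ∃ m : ℕ, c'.1 - 2 * m < c.1 := ⟨(c'.1 - c.1).toNat + 1, by omega⟩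
  have hleft := G.iterate_left (even_of_mem_incoming hc') (G.iterate_mem_of_mem_incoming hy' hc')
    (Or.inl hcX'.le) m
  have hinv := G.flowBelow_iterate hV (f := (x, y')) he (G.iterate_mem_of_mem_incoming hy' hs)
    (fun j hj => by
      have h1 := even_snd_of_mem_incoming hj
      have h2 := even_iterate_snd d (x, y') j
      tauto) (m + k)
  rw [Function.iterate_add_apply, hk, hleft] at hinv
  simp only at hinv
  have hce := even_of_mem_incoming hc'
  rw [G.flowBelow_right hy (G.incoming_subset hy) hx he hyy',
    G.flowBelow_left hy hc hcX hm (by grind) (by tauto)] at hinv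
  split_ifs at hinv <;> omega

/-- An incoming path leaves on the row on which it came in. The outgoing row increases strictly with
the incoming one; counting up from the lowest row `Y₀` gives one inequality, and counting down from
the rows above `Y`, which are left unchanged, gives the other. -/
lemma snd_eq_of_left (G : GlideSystem Ω d X Y Y₀) {y : ℤ} (hy : Y₀ ≤ y) {c : Cell}
    (hc : c ∈ incoming d X y) (hcX : c.1 < -X) : c.2 = y := by
  have hge : ∀ (m : ℕ) (c : Cell), c ∈ incoming d X (Y₀ + m) → c.1 < -X → Y₀ + m ≤ c.2 := by
    intro m
    induction m with
    | zero =>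
      intro c hc hcX
      simpa using G.low c (G.incoming_subset (by simp) hc) hcX.le
    | succ m ih =>
      intro c hc hcX
      obtain ⟨b, hb, hbX⟩ := G.exists_mem_incoming_left (y := Y₀ + m) (by omega)
      have h1 := ih b hb hbX
      have h2 := (G.lt_iff_lt (by omega) (by omega) (by push_cast; grind) hb hc hbX hcX).1
        (by push_cast; omega)
      push_cast
      omega
  have hle : ∀ (m : ℕ) (y : ℤ), Y₀ ≤ y → Y ≤ y + m → ∀ c ∈ incoming d X y, c.1 < -X →
      c.2 ≤ y := by
    intro m
    induction m with
    | zero =>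
      rintro y hy hY c ⟨x, k, hx, he, rfl⟩ -
      rw [G.iterate_left (c := (x, y)) he (G.iterate_mem_of_mem_incoming hy ⟨x, 0, hx, he, rfl⟩)
        (Or.inr (by simpa using hY)) k]
    | succ m ih =>
      intro y hy hY c hc hcX
      obtain ⟨b, hb, hbX⟩ := G.exists_mem_incoming_left (y := y + 1) (by omega)
      have h1 := ih (y + 1) (by omega) (by push_cast at hY; omega) b hb hbX
      have h2 := (G.lt_iff_lt hy (by omega) (by grind) hc hb hcX hbX).1 (by omega)
      omega
  refine le_antisymm (hle (Y - y).toNat y hy (by omega) c hc hcX) ?_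
  have := hge (y - Y₀).toNat c
  rw [show Y₀ + ((y - Y₀).toNat : ℤ) = y by omega] at this
  exact this hc hcX

lemma glide_injective (G : GlideSystem Ω d X Y Y₀) {y y' : ℤ} (hy : Y₀ ≤ y) (hy' : Y₀ ≤ y')
    {c c' : Cell} (hc : c ∈ incoming d X y) (hc' : c' ∈ incoming d X y')
    (h : glide d c = glide d c') : c = c' := by
  obtain ⟨k, hk⟩ := G.exists_iterate_left hy (glide_mem_incoming hc)
  have h1 := G.snd_eq_of_left hy (iterate_mem_incoming (glide_mem_incoming hc) k) hk
  rw [h] at h1 hk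
  obtain rfl : y = y' :=
    h1.symm.trans (G.snd_eq_of_left hy' (iterate_mem_incoming (glide_mem_incoming hc') k) hk)
  exact (G.isCurrent_incoming hy (G.incoming_subset hy)).bijOn.injOn hc hc' h

end GlideSystem

/-! ### Gliding paths in a finite region with caps -/

/-- The gliding paths in `R` starting in `S` transport `S` to `S'`: they can leave `R` only to `S'`,
they reach all of `S'`, they do not merge with each other or pass through `S` again, and they do not
get trapped in `R`. -/
structure Transports (step : Cell → Cell → Prop) (R S S' : Set Cell) : Prop where
  mem_or_mem : ∀ s ∈ S, ∀ c, Relation.ReflTransGen step s c → c ∈ R ∨ c ∈ S'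
  exists_start : ∀ c ∈ S', ∃ s ∈ S, Relation.ReflTransGen step s c
  inj : ∀ s ∈ S, ∀ s' ∈ S, ∀ c c' e, Relation.ReflTransGen step s c →
    Relation.ReflTransGen step s' c' → step c e → step c' e → c = c'
  not_mem : ∀ s ∈ S, ∀ c e, Relation.ReflTransGen step s c → step c e → e ∉ S
  exists_exit : ∀ s ∈ S, ∀ c, Relation.ReflTransGen step s c →
    ∃ s' ∈ S', Relation.ReflTransGen step c s'

/-- The relation may be verified after applying an involution, such as a reflection. -/
lemma Transports.of_involutive {μ : Cell → Cell} (hμ : Function.Involutive μ)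
    {step : Cell → Cell → Prop} {R S S' : Set Cell}
    (h : Transports (fun c e => step (μ c) (μ e)) (μ ⁻¹' R) (μ ⁻¹' S) (μ ⁻¹' S')) :
    Transports step R S S' := by
  have h1 : ∀ a b, Relation.ReflTransGen step a b →
      Relation.ReflTransGen (fun c e => step (μ c) (μ e)) (μ a) (μ b) := fun a b hab =>
    hab.lift μ fun a b h => by simpa only [Function.onFun, hμ _] using h
  have h2 : ∀ a b, Relation.ReflTransGen (fun c e => step (μ c) (μ e)) a b →
      Relation.ReflTransGen step (μ a) (μ b) := fun a b hab => hab.lift μ fun a b h => h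
  have hs : ∀ {A : Set Cell} {c}, c ∈ A → μ c ∈ μ ⁻¹' A := fun {A c} hc => by
    simpa only [mem_preimage, hμ c] using hc
  refine ⟨fun s hs' c hc => ?_, fun c hc => ?_, fun s hs₁ s' hs₂ c c' e hc hc' he he' => ?_,
    fun s hs' c e hc he => ?_, fun s hs' c hc => ?_⟩
  · have := h.mem_or_mem _ (hs hs') _ (h1 _ _ hc)
    simpa only [mem_preimage, hμ c] using this
  · obtain ⟨s, hs', h'⟩ := h.exists_start _ (hs hc)
    exact ⟨μ s, hs', by simpa only [hμ c] using h2 _ _ h'⟩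
  · exact hμ.injective (h.inj _ (hs hs₁) _ (hs hs₂) _ _ (μ e) (h1 _ _ hc) (h1 _ _ hc')
      (by simpa only [hμ _] using he) (by simpa only [hμ _] using he'))
  · have := h.not_mem _ (hs hs') _ (μ e) (h1 _ _ hc) (by simpa only [hμ _] using he)
    simpa only [mem_preimage, hμ e] using this
  · obtain ⟨s, hs', h'⟩ := h.exists_exit _ (hs hs') _ (h1 _ _ hc)
    exact ⟨μ s, hs', by simpa only [hμ c] using h2 _ _ h'⟩

/-- The half Aztec diamond of order `n - 1` which sits right-justified above height `2 n`. -/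
def rightCap (n : ℤ) : Set Cell := {c | 2 * n ≤ c.2 ∧ c.2 - 2 * n + 1 ≤ c.1 ∧ c.1 ≤ 4 * n - 2 - c.2}

/-- The half Aztec diamond of order `n - 1` which sits left-justified above height `2 n`. -/
def leftCap (n : ℤ) : Set Cell := {c | 2 * n ≤ c.2 ∧ c.2 - 2 * n ≤ c.1 ∧ c.1 ≤ 4 * n - 3 - c.2}

/-- The properties shared by `halfSquare n` and its mirror image that are needed for gliding in a
region consisting of `Q` and a cap above it. By `neighbor_mem`, squares of `Q` have no neighbours
below the cut with both coordinates even. -/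
structure IsBase (Q : Set Cell) (n : ℤ) : Prop where
  nonneg : 0 ≤ n
  bounds : ∀ c ∈ Q, 0 ≤ c.2 ∧ c.2 < 2 * n ∧ -(2 * n + 2) < c.1 ∧ c.1 < 2 * n + 2
  up : ∀ x y y', (x, y) ∈ Q → y ≤ y' → y' < 2 * n → (x, y') ∈ Q
  neighbor_mem : ∀ c ∈ Q, ∀ v, IsUnitVector v → Even (c + v).1 → Even (c + v).2 → (c + v).2 < 2 * n →
    c + v ∈ Q
  top_row : ∀ c ∈ Q, c.2 = 2 * n - 1 → 0 ≤ c.1 ∧ c.1 ≤ 2 * n - 2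

open Classical in
/-- The extension of the matching `d` of `R` that matches a square outside `R` with its left
neighbour. -/
noncomputable def extendLeft (R : Set Cell) (d : Cell → Cell) (c : Cell) : Cell :=
  if c ∈ R then d c else (-1, 0)

section
variable {Q : Set Cell} {n : ℤ} {d : Cell → Cell}

lemma glide_extendLeft_of_mem {R : Set Cell} {c : Cell} (hc : c ∈ R) :
    glide (extendLeft R d) c = glide d c := by
  simp [glide, extendLeft, hc]

lemma glide_extendLeft_of_notMem {R : Set Cell} {c : Cell} (hc : c ∉ R) :
    glide (extendLeft R d) c = (c.1 - 2, c.2) := by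
  simp only [glide, extendLeft, hc, if_false]
  ext <;> simp; ring

lemma glideSystem_extendLeft (hQ : IsBase Q n)
    (hd : ∀ c ∈ Q ∪ rightCap n, Even (c.1 + c.2) → IsUnitVector (d c))
    (hmem : ∀ c ∈ Q ∪ rightCap n, Even (c.1 + c.2) → c + d c ∈ Q ∪ rightCap n)
    (hinj : ∀ c ∈ Q ∪ rightCap n, ∀ c' ∈ Q ∪ rightCap n, Even (c.1 + c.2) → Even (c'.1 + c'.2) →
      c + d c = c' + d c' → c = c') :
    GlideSystem (Q ∪ {c | 2 * n ≤ c.2}) (extendLeft (Q ∪ rightCap n) d)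
      (2 * n + 2) (3 * n) (2 * n) := by
  have hn := hQ.nonneg
  have hsub : Q ∪ rightCap n ⊆ Q ∪ {c | 2 * n ≤ c.2} := union_subset_union_right _ fun c hc => hc.1
  have hout : ∀ c ∈ Q ∪ {c | 2 * n ≤ c.2}, c ∉ Q ∪ rightCap n → 2 * n ≤ c.2 := by
    rintro c (hc | hc) hc'
    · exact absurd (Or.inl hc) hc'
    · exact hc
  -- the left neighbour of an even square outside `R` is not in `R`, by parity
  have hcross : ∀ c ∈ Q ∪ rightCap n, ∀ c' ∈ Q ∪ {c | 2 * n ≤ c.2}, c' ∉ Q ∪ rightCap n →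
      Even (c.1 + c.2) → Even (c'.1 + c'.2) → c + d c ≠ c' + (-1, 0) := by
    intro c hc c' hc' hcR' he he' h
    have h1 := hmem c hc he
    have h2 := hout c' hc' hcR'
    rw [h] at h1
    rcases h1 with h1 | h1
    · have := (hQ.bounds _ h1).2.1
      simp at this; omega
    · refine hcR' (Or.inr ⟨h2, ?_⟩)
      obtain ⟨-, h3, h4⟩ := h1
      simp at h3 h4
      refine ⟨by omega, ?_⟩
      by_contra h5
      have : c'.1 + c'.2 = 2 * (2 * n - 1) + 1 := by omega
      grind
  refine ⟨fun c hc he => ?_, fun c hc he => ?_, fun c hc c' hc' he he' h => ?_,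
    fun x y y' h hy => ?_, fun c hc => ?_, fun c hc h1 h2 => ?_, fun c hc he h => ?_,
    fun x y h => Or.inr h, fun c hc h => ?_, even_two_mul n⟩
  · by_cases hR : c ∈ Q ∪ rightCap n
    · simpa only [extendLeft, hR, if_true] using hd c hR he
    · simp only [extendLeft, hR, if_false]; exact Or.inr (Or.inl rfl)
  · by_cases hR : c ∈ Q ∪ rightCap n
    · simpa only [extendLeft, hR, if_true] using hsub (hmem c hR he)
    · simp only [extendLeft, hR, if_false]
      exact Or.inr (by simpa using hout c hc hR)
  · by_cases hR : c ∈ Q ∪ rightCap n <;> by_cases hR' : c' ∈ Q ∪ rightCap n <;>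
      simp only [extendLeft, hR, hR', if_true, if_false] at h
    · exact hinj c hR c' hR' he he' h
    · exact absurd h (hcross c hR c' hc' hR' he he')
    · exact absurd h.symm (hcross c' hR' c hc hR he' he)
    · exact add_right_cancel h
  · by_cases hy' : 2 * n ≤ y'
    · exact Or.inr hy'
    · rcases h with h | h
      · exact Or.inl (hQ.up x y y' h hy (by omega))
      · simp at h; omega
  · rcases hc with hc | hc
    · exact (hQ.bounds c hc).1
    · simp at hc; omega
  · by_cases hR : c ∈ Q ∪ rightCap n
    · rw [glide_extendLeft_of_mem hR]
      have he : Even (c.1 + c.2) := h1.add h2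
      have h1' : Even (glide d c).1 := by rw [glide_fst]; grind
      have h2' : Even (glide d c).2 := by rw [glide_snd]; grind
      by_cases hlt : 2 * n ≤ (glide d c).2
      · exact Or.inr hlt
      rcases hmem c hR he with h | h
      · exact Or.inl (hQ.neighbor_mem _ h _ (hd c hR he) h1' h2' (by rw [glide] at hlt; omega))
      · exfalso
        have hu := hd c hR he
        have := h.1
        rw [glide_snd] at hlt
        rw [Prod.snd_add] at this
        rcases hu with h' | h' | h' | h' <;> rw [h'] at hlt this <;> simp only at hlt this <;> grind
    · rw [glide_extendLeft_of_notMem hR]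
      exact Or.inr (hout c hc hR)
  · have hR : c ∉ Q ∪ rightCap n := by
      rintro (hR | ⟨h1, h2, h3⟩)
      · have := hQ.bounds c hR; omega
      · omega
    simp only [extendLeft, hR, if_false]
  · rcases hc with hc | hc
    · have := hQ.bounds c hc; omega
    · exact hc

/-- The paths starting at the right boundary of the cap end at its left boundary, on the same row. -/
lemma transports_of_isBase (hQ : IsBase Q n)
    (hd : ∀ c ∈ Q ∪ rightCap n, Even (c.1 + c.2) → IsUnitVector (d c))
    (hmem : ∀ c ∈ Q ∪ rightCap n, Even (c.1 + c.2) → c + d c ∈ Q ∪ rightCap n)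
    (hinj : ∀ c ∈ Q ∪ rightCap n, ∀ c' ∈ Q ∪ rightCap n, Even (c.1 + c.2) → Even (c'.1 + c'.2) →
      c + d c = c' + d c' → c = c') {step : Cell → Cell → Prop}
    (hstep : ∀ c e, step c e ↔ c ∈ Q ∪ rightCap n ∧ e = glide d c) :
    Transports step (Q ∪ rightCap n) (rightCap n \ leftCap n) (leftCap n \ rightCap n) := by
  have G := glideSystem_extendLeft hQ hd hmem hinj
  have hn := hQ.nonneg
  set R := Q ∪ rightCap n with hR
  set D := extendLeft R d with hD
  have hS : ∀ s ∈ rightCap n \ leftCap n, 2 * n ≤ s.2 ∧ s.1 = 4 * n - 2 - s.2 ∧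
      s.2 - 2 * n + 1 ≤ s.1 := by
    rintro s ⟨⟨h1, h2, h3⟩, h4⟩
    refine ⟨h1, ?_, h2⟩
    by_contra h
    exact h4 ⟨h1, by omega, by omega⟩
  have hS' : ∀ y, 2 * n ≤ y → y - 2 * n ≤ 4 * n - 3 - y → (y - 2 * n, y) ∈ leftCap n \ rightCap n := by
    intro y h1 h2
    exact ⟨⟨h1, le_rfl, h2⟩, fun h => by have := h.2.1; simp at this⟩
  have hnotMem : ∀ c : Cell, 2 * n ≤ c.2 → (c.1 ≤ c.2 - 2 * n ∨ 4 * n - 1 - c.2 ≤ c.1) → c ∉ R := by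
    rintro c h1 h2 (h | ⟨h3, h4, h5⟩)
    · have := hQ.bounds c h; omega
    · omega
  have hray : ∀ x y, 2 * n ≤ y → 4 * n - 2 - y ≤ x → Even (x + y) →
      (x, y) ∈ incoming D (2 * n + 2) y := by
    intro x y hy hx he
    have : ∀ m : ℕ, (glide D)^[m] (x + 2 * m, y) = (x, y) := by
      intro m
      induction m with
      | zero => simp
      | succ m ih =>
        rw [Function.iterate_succ_apply, glide_extendLeft_of_notMem
          (hnotMem _ hy (Or.inr (by push_cast; omega))), ← ih]
        congr 2; push_cast; ring
    exact ⟨x + 2 * (2 * n + 2 - x).toNat, _, by omega, by grind, this _⟩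
  -- a path from `s` first leaves `R` on the row of `s`
  have hpath : ∀ s ∈ rightCap n \ leftCap n, ∀ c, Relation.ReflTransGen step s c →
      c ∈ incoming D (2 * n + 2) s.2 ∧ (c ∈ R ∨ c = (s.2 - 2 * n, s.2)) := by
    intro s hs c hc
    obtain ⟨hs1, hs2, hs3⟩ := hS s hs
    induction hc with
    | refl => exact ⟨hray s.1 s.2 hs1 hs2.ge (by grind), Or.inl (Or.inr hs.1)⟩
    | @tail b e _ hbe ih =>
      obtain ⟨hbR, rfl⟩ := (hstep b e).1 hbe
      have hin : glide d b ∈ incoming D (2 * n + 2) s.2 := by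
        rw [← glide_extendLeft_of_mem hbR]
        exact glide_mem_incoming ih.1
      refine ⟨hin, or_iff_not_imp_left.2 fun heR => ?_⟩
      have hbe := even_of_mem_incoming ih.1
      have hee := even_of_mem_incoming hin
      have hy : 2 * n ≤ (glide d b).2 := by
        rcases G.incoming_subset hs1 hin with h | h
        · exact absurd (Or.inl h) heR
        · exact h
      -- by parity, a path can leave `R` only through the left boundary of the cap
      have hx : (glide d b).1 = (glide d b).2 - 2 * n := by
        have hor : (glide d b).1 ≤ (glide d b).2 - 2 * n ∨
            4 * n - (glide d b).2 ≤ (glide d b).1 := by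
          by_contra hcon
          refine heR (Or.inr ⟨hy, by omega, ?_⟩)
          by_contra h
          have : (glide d b).1 + (glide d b).2 = 2 * (2 * n - 1) + 1 := by omega
          grind
        have hfst : (glide d b).1 = (b + d b).1 + (d b).1 := rfl
        have hsnd : (glide d b).2 = (b + d b).2 + (d b).2 := rfl
        have hu := hd b hbR hbe
        rcases hmem b hbR hbe with h | ⟨h1, h2, h3⟩
        · have hb := hQ.bounds _ h
          have ht := hQ.top_row _ h
          rcases hu with h' | h' | h' | h' <;> rw [h'] at hfst hsnd hb ht <;>
            simp only at hfst hsnd <;> omega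
        · rcases hu with h' | h' | h' | h' <;> rw [h'] at hfst hsnd h1 h2 h3 <;>
            simp only at hfst hsnd <;> omega
      generalize glide d b = e at *
      obtain ⟨x, z⟩ := e
      simp only at hy hx
      subst hx
      -- from there it glides on to the far left, hence it came in on this row
      have hl : ∀ m : ℕ, (glide D)^[m] (z - 2 * n, z) = (z - 2 * n - 2 * m, z) := by
        intro m
        induction m with
        | zero => simp
        | succ m ih =>
          rw [Function.iterate_succ_apply', ih, glide_extendLeft_of_notMem
            (hnotMem _ hy (Or.inl (by simp only; omega)))]
          ext <;> simp; ring
      have := iterate_mem_incoming hin (z + 2).toNat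
      rw [hl] at this
      have := G.snd_eq_of_left hs1 this (by simp only; omega)
      simp only at this
      rw [this]
  have hexit : ∀ s ∈ rightCap n \ leftCap n, ∀ c, Relation.ReflTransGen step s c →
      Relation.ReflTransGen step c (s.2 - 2 * n, s.2) := by
    classical
    intro s hs c hc
    have hex : ∃ k, (glide D)^[k] c ∉ R := by
      obtain ⟨k, hk⟩ := G.exists_iterate_left (hS s hs).1 (hpath s hs c hc).1
      refine ⟨k, ?_⟩
      rintro (h | ⟨h1, h2, h3⟩)
      · have := hQ.bounds _ h; omega
      · omega
    have hreach : ∀ k ≤ Nat.find hex, Relation.ReflTransGen step c ((glide D)^[k] c) := by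
      intro k
      induction k with
      | zero => exact fun _ => .refl
      | succ k ih =>
        intro hk
        have hkR := not_not.1 (Nat.find_min hex (Nat.lt_of_succ_le hk))
        refine (ih (by omega)).tail ((hstep _ _).2 ⟨hkR, ?_⟩)
        rw [Function.iterate_succ_apply', glide_extendLeft_of_mem hkR]
    have h := hreach _ le_rfl
    rwa [((hpath s hs _ (hc.trans h)).2.resolve_left (Nat.find_spec hex))] at h
  refine ⟨fun s hs c hc => ?_, fun c hc => ?_, fun s hs s' hs' c c' e hc hc' he he' => ?_,
    fun s hs c e hc he heS => ?_, fun s hs c hc => ?_⟩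
  · refine (hpath s hs c hc).2.imp_right ?_
    rintro rfl
    have := hS s hs
    exact hS' _ (by omega) (by omega)
  · obtain ⟨⟨h1, h2, h3⟩, h4⟩ := hc
    have h5 : c.1 = c.2 - 2 * n := by
      by_contra h
      exact h4 ⟨h1, by omega, by omega⟩
    have hs : (4 * n - 2 - c.2, c.2) ∈ rightCap n \ leftCap n :=
      ⟨⟨h1, by simp only; omega, le_rfl⟩, fun h => by have := h.2.2; simp at this; omega⟩
    refine ⟨_, hs, ?_⟩
    have := hexit _ hs _ .refl
    simp only [← h5] at this
    exact this
  · obtain ⟨hcR, rfl⟩ := (hstep _ _).1 he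
    obtain ⟨hcR', h⟩ := (hstep _ _).1 he'
    rw [← glide_extendLeft_of_mem hcR, ← glide_extendLeft_of_mem hcR'] at h
    exact G.glide_injective (hS s hs).1 (hS s' hs').1 (hpath s hs c hc).1 (hpath s' hs' c' hc').1 h
  -- in the extended matching, the right neighbour `e + (2, 0)` of `e ∈ S` glides to `e`
  · obtain ⟨hcR, rfl⟩ := (hstep _ _).1 he
    have hE := hS _ heS
    rw [← glide_extendLeft_of_mem hcR] at hE
    set e := glide D c with he'
    have hnot := hnotMem (e.1 + 2, e.2) hE.1 (Or.inr (by simp only; omega))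
    have hin := hray (e.1 + 2) e.2 hE.1 (by omega) (by grind)
    refine hnot (G.glide_injective (hS s hs).1 hE.1 (hpath s hs c hc).1 hin ?_ ▸ hcR)
    rw [glide_extendLeft_of_notMem hnot, ← he']
    ext <;> simp
  · have := hS s hs
    exact ⟨_, hS' s.2 (by omega) (by omega), hexit s hs c hc⟩

end

/-! ### Shifting a tiling -/

lemma IsUnitVector.ne_zero {v : Cell} (h : IsUnitVector v) : v ≠ 0 := by
  rcases h with rfl | rfl | rfl | rfl <;> simp

lemma IsUnitVector.not_even_add {c v : Cell} (h : IsUnitVector v) (hc : Even (c.1 + c.2)) :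
    ¬ Even ((c + v).1 + (c + v).2) := by
  rcases h with rfl | rfl | rfl | rfl <;> simp only [Prod.fst_add, Prod.snd_add] <;> grind

lemma isDomino_pair {c v : Cell} (h : IsUnitVector v) : IsDomino {c, c + v} := by
  rcases h with rfl | rfl | rfl | rfl
  · exact ⟨c, Or.inl rfl⟩
  · refine ⟨c + (-1, 0), Or.inl ?_⟩
    rw [add_assoc, pair_comm]; simp [Prod.mk_zero_zero]
  · exact ⟨c, Or.inr rfl⟩
  · refine ⟨c + (0, -1), Or.inr ?_⟩
    rw [add_assoc, pair_comm]; simp [Prod.mk_zero_zero]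

lemma IsDomino.exists_eq_pair {D : Set Cell} (h : IsDomino D) {c : Cell} (hc : c ∈ D) :
    ∃ v, IsUnitVector v ∧ D = {c, c + v} := by
  obtain ⟨a, rfl | rfl⟩ := h <;> rcases hc with rfl | rfl
  · exact ⟨_, Or.inl rfl, rfl⟩
  · refine ⟨(-1, 0), Or.inr (Or.inl rfl), ?_⟩
    rw [add_assoc, pair_comm]; simp [Prod.mk_zero_zero]
  · exact ⟨_, Or.inr (Or.inr (Or.inl rfl)), rfl⟩
  · refine ⟨(0, -1), Or.inr (Or.inr (Or.inr rfl)), ?_⟩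
    rw [add_assoc, pair_comm]; simp [Prod.mk_zero_zero]

namespace DominoTiling
variable {R R' : Set Cell}

/-- Every square `c` of the region is covered by a domino `{c, c + d c}`, and by no other. -/
lemma exists_direction (t : DominoTiling R) : ∃ d : Cell → Cell,
    (∀ c ∈ R, IsUnitVector (d c) ∧ ({c, c + d c} : Set Cell) ∈ t.tiles) ∧
      ∀ c v, ({c, c + v} : Set Cell) ∈ t.tiles → c ∈ R ∧ v = d c := by
  classical
  have h : ∀ c ∈ R, ∃ v, IsUnitVector v ∧ ({c, c + v} : Set Cell) ∈ t.tiles := by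
    intro c hc
    obtain ⟨D, ⟨hD, hcD⟩, -⟩ := t.existsUnique_mem c hc
    obtain ⟨v, hv, rfl⟩ := (t.isDomino D hD).exists_eq_pair hcD
    exact ⟨v, hv, hD⟩
  choose! d hd using h
  refine ⟨d, hd, fun c v hcv => ?_⟩
  have hc : c ∈ R := t.subset _ hcv (by simp)
  refine ⟨hc, ?_⟩
  have heq : ({c, c + v} : Set Cell) = {c, c + d c} :=
    (t.existsUnique_mem c hc).unique ⟨hcv, by simp⟩ ⟨(hd c hc).2, by simp⟩
  have hmem : c + d c ∈ ({c, c + v} : Set Cell) := heq ▸ by simp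
  rcases hmem with h | h
  · exact absurd (by simpa using h) (hd c hc).1.ne_zero
  · exact (add_left_cancel h).symm

lemma eq_of_pair_mem (t : DominoTiling R) {c c' o v v' : Cell}
    (h : ({c, c + v} : Set Cell) ∈ t.tiles) (h' : ({c', c' + v'} : Set Cell) ∈ t.tiles)
    (ho : o ∈ ({c, c + v} : Set Cell)) (ho' : o ∈ ({c', c' + v'} : Set Cell)) :
    ({c, c + v} : Set Cell) = {c', c' + v'} :=
  (t.existsUnique_mem o (t.subset _ h ho)).unique ⟨h, ho⟩ ⟨h', ho'⟩

lemma isUnitVector_of_pair_mem (t : DominoTiling R) {c v : Cell}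
    (h : ({c, c + v} : Set Cell) ∈ t.tiles) : IsUnitVector v := by
  obtain ⟨d, hd, hd'⟩ := t.exists_direction
  obtain ⟨hc, rfl⟩ := hd' c v h
  exact (hd c hc).1

lemma even_of_visited {t : Set (Set Cell)} {S : Set Cell} (hS : ∀ c ∈ S, Even (c.1 + c.2))
    {c : Cell} (hc : Visited t S c) : Even (c.1 + c.2) := by
  obtain ⟨s, hs, h⟩ := hc
  induction h with
  | refl => exact hS s hs
  | tail _ h ih =>
    obtain ⟨v, -, rfl⟩ := h
    simp only [Prod.fst_add, Prod.snd_add]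
    grind

lemma visited_step {t : Set (Set Cell)} {S : Set Cell} {c v : Cell} (hc : Visited t S c)
    (h : ({c, c + v} : Set Cell) ∈ t) : Visited t S (c + v + v) := by
  obtain ⟨s, hs, h'⟩ := hc
  exact ⟨s, hs, h'.tail ⟨v, h, rfl⟩⟩

/-- The shift of a tiling `t` of `R` as a tiling of `R'`. A visited square of `R'` is covered by the new
domino of the unique step leading to it, an odd square followed by a visited one is covered by the
new domino of that step, and everything else is covered as in `t`. -/
def shiftTiling (t : DominoTiling R)
    (hT : Transports (GlideStep t.tiles) R (R \ R') (R' \ R))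
    (hS : ∀ c ∈ R \ R', Even (c.1 + c.2)) : DominoTiling R' where
  tiles := shift t.tiles (R \ R')
  isDomino := by
    rintro D (⟨hD, -⟩ | ⟨c, v, -, hD, rfl⟩)
    · exact t.isDomino D hD
    · exact isDomino_pair (t.isUnitVector_of_pair_mem hD)
  subset := by
    rintro D (⟨hD, hV⟩ | ⟨c, v, hc, hD, rfl⟩)
    · intro a ha
      by_contra haR'
      exact hV a ha ⟨a, ⟨t.subset D hD ha, haR'⟩, .refl⟩
    · have hce := even_of_visited hS hc
      rintro a (rfl | rfl)
      · by_contra h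
        exact (t.isUnitVector_of_pair_mem hD).not_even_add hce
          (hS _ ⟨t.subset _ hD (by simp), h⟩)
      · obtain ⟨s, hs, h⟩ := visited_step hc hD
        rcases hT.mem_or_mem s hs _ h with h' | h'
        · by_contra h''
          obtain ⟨s, hs, h⟩ := hc
          exact hT.not_mem s hs _ _ h ⟨v, hD, rfl⟩ ⟨h', h''⟩
        · exact h'.1
  existsUnique_mem := by
    intro a ha
    by_cases haV : Visited t.tiles (R \ R') a
    · obtain ⟨s, hs, h⟩ := haV
      rcases h.cases_tail with h' | ⟨c, hc, v, hD, rfl⟩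
      · exact absurd ha (h' ▸ hs.2)
      have hcV : Visited t.tiles (R \ R') c := ⟨s, hs, hc⟩
      have hce := even_of_visited hS hcV
      refine ⟨{c + v, c + v + v}, ⟨Or.inr ⟨c, v, hcV, hD, rfl⟩, by simp⟩, ?_⟩
      rintro D ⟨⟨hD', hV⟩ | ⟨c', v', hc', hD', rfl⟩, haD⟩
      · exact absurd ⟨s, hs, h⟩ (hV _ haD)
      have hce' := even_of_visited hS hc'
      have haD' : c + v + v = c' + v' + v' := by
        rcases haD with h' | h'
        · exact absurd (h' ▸ even_of_visited hS ⟨s, hs, h⟩)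
            ((t.isUnitVector_of_pair_mem hD').not_even_add hce')
        · exact h'
      obtain ⟨s', hs', h'⟩ := hc'
      obtain rfl := hT.inj s hs s' hs' c c' (c + v + v) hc h' ⟨v, hD, rfl⟩ ⟨v', hD', haD'⟩
      obtain ⟨d, -, hd⟩ := t.exists_direction
      rw [(hd _ _ hD).2, (hd _ _ hD').2]
    · have haR : a ∈ R := by
        by_contra h
        exact haV (hT.exists_start a ⟨ha, h⟩)
      obtain ⟨d, hd, -⟩ := t.exists_direction
      obtain ⟨hda, htile⟩ := hd a haR
      by_cases hcV : Visited t.tiles (R \ R') (a + d a)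
      · have htile' : ({a + d a, a + d a + -d a} : Set Cell) ∈ t.tiles := by
          rwa [add_neg_cancel_right, pair_comm]
        refine ⟨{a, a + -d a}, ⟨Or.inr ⟨a + d a, -d a, hcV, htile', by simp⟩, by simp⟩, ?_⟩
        rintro D ⟨⟨hD', hV⟩ | ⟨c', v', hc', hD', rfl⟩, haD⟩
        · obtain rfl := (t.existsUnique_mem a haR).unique ⟨hD', haD⟩ ⟨htile, by simp⟩
          exact absurd hcV (hV _ (by simp))
        · rcases haD with rfl | rfl
          · have h1 := t.eq_of_pair_mem hD' htile (o := c' + v') (by simp) (by simp)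
            have h2 : c' ∈ ({c' + v', c' + v' + d (c' + v')} : Set Cell) := h1 ▸ by simp
            rcases h2 with h2 | h2
            · exact absurd (h2 ▸ hc') haV
            · have : v' = - d (c' + v') := by
                have : c' + (v' + d (c' + v')) = c' + 0 := by rw [← add_assoc, ← h2, add_zero]
                exact eq_neg_of_add_eq_zero_left (add_left_cancel this)
              rw [← this]
          · exact absurd (visited_step hc' hD') haV
      · refine ⟨{a, a + d a}, ⟨Or.inl ⟨htile, ?_⟩, by simp⟩, ?_⟩
        · rintro c (rfl | rfl)
          exacts [haV, hcV]
        · rintro D ⟨⟨hD', hV⟩ | ⟨c', v', hc', hD', rfl⟩, haD⟩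
          · exact (t.existsUnique_mem a haR).unique ⟨hD', haD⟩ ⟨htile, by simp⟩
          · rcases haD with rfl | rfl
            · have h1 := t.eq_of_pair_mem hD' htile (o := c' + v') (by simp) (by simp)
              have h2 : c' ∈ ({c' + v', c' + v' + d (c' + v')} : Set Cell) := h1 ▸ by simp
              rcases h2 with h2 | h2
              · exact absurd (h2 ▸ hc') haV
              · exact absurd (h2 ▸ hc') hcV
            · exact absurd (visited_step hc' hD') haV

/-- Shifting back: the gliding paths of the shifted tiling starting in `R' \ R` are the gliding paths
of `t` in reverse, so the same squares are visited. -/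
lemma shift_shift (t : DominoTiling R)
    (hT : Transports (GlideStep t.tiles) R (R \ R') (R' \ R))
    (hS : ∀ c ∈ R \ R', Even (c.1 + c.2)) :
    shift (shift t.tiles (R \ R')) (R' \ R) = t.tiles := by
  -- the shifted tiling glides back from visited squares along the steps of `t`
  have hback : ∀ c v, Visited t.tiles (R \ R') c →
      ({c, c + v} : Set Cell) ∈ shift t.tiles (R \ R') →
      Visited t.tiles (R \ R') (c + v + v) ∧ ({c + v + v, c + v} : Set Cell) ∈ t.tiles := by
    rintro c v hc (⟨-, hV⟩ | ⟨b, w, hb, hbw, heq⟩)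
    · exact absurd hc (hV c (by simp))
    · have hbe := even_of_visited hS hb
      have hce := even_of_visited hS hc
      have hw := t.isUnitVector_of_pair_mem hbw
      have hc' : c = b + w + w := by
        have : c ∈ ({b + w, b + w + w} : Set Cell) := heq ▸ by simp
        rcases this with rfl | h
        · exact absurd hce (hw.not_even_add hbe)
        · exact h
      have hv : c + v = b + w := by
        have : b + w ∈ ({c, c + v} : Set Cell) := heq ▸ by simp
        rcases this with h | h
        · exact absurd (h ▸ hce) (hw.not_even_add hbe)
        · exact h.symm
      have hv' : v = -w := by
        rw [hc', add_assoc (b + w)] at hv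
        exact eq_neg_of_add_eq_zero_right (by simpa using hv)
      rw [hv, hv', add_neg_cancel_right]
      exact ⟨hb, hbw⟩
  have hrev : ∀ c e, Relation.ReflTransGen (GlideStep t.tiles) c e →
      Visited t.tiles (R \ R') c → Relation.ReflTransGen (GlideStep (shift t.tiles (R \ R'))) e c := by
    intro c e h hc
    induction h using Relation.ReflTransGen.head_induction_on with
    | refl => exact .refl
    | @head a b hab _ ih =>
      obtain ⟨v, hv, rfl⟩ := hab
      refine (ih (visited_step hc hv)).tail ⟨-v, Or.inr ⟨a, v, hc, hv, ?_⟩, by simp⟩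
      rw [add_neg_cancel_right, pair_comm]
  have hvis : ∀ c, Visited (shift t.tiles (R \ R')) (R' \ R) c ↔ Visited t.tiles (R \ R') c := by
    intro c
    constructor
    · rintro ⟨s, hs, h⟩
      induction h with
      | refl => exact hT.exists_start s hs
      | tail _ h ih =>
        obtain ⟨v, hv, rfl⟩ := h
        exact (hback _ _ ih hv).1
    · rintro ⟨s, hs, h⟩
      obtain ⟨e, he, h'⟩ := hT.exists_exit s hs c h
      exact ⟨e, he, hrev _ _ h' ⟨s, hs, h⟩⟩
  ext D
  constructor
  · rintro (⟨⟨hD, -⟩ | ⟨c, v, hc, hD, rfl⟩, hV⟩ | ⟨c, v, hc, hD, rfl⟩)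
    · exact hD
    · exact absurd ((hvis _).2 (visited_step hc hD)) (hV _ (by simp))
    · rw [pair_comm]
      exact (hback c v ((hvis c).1 hc) hD).2
  · intro hD
    by_cases h : ∃ c ∈ D, Visited t.tiles (R \ R') c
    · obtain ⟨c, hcD, hc⟩ := h
      obtain ⟨v, -, rfl⟩ := (t.isDomino D hD).exists_eq_pair hcD
      refine Or.inr ⟨c + v + v, -v, (hvis _).2 (visited_step hc hD),
        Or.inr ⟨c, v, hc, hD, ?_⟩, ?_⟩
      · rw [add_neg_cancel_right, pair_comm]
      · rw [add_neg_cancel_right, add_neg_cancel_right, pair_comm]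
    · push Not at h
      exact Or.inl ⟨Or.inl ⟨hD, h⟩, fun c hc h' => h c hc ((hvis c).1 h')⟩

end DominoTiling

/-! ### The Aztec triangles -/

lemma mem_topHalf (k : ℤ) (c : Cell) :
    c ∈ topHalfAztecDiamond k ↔ 0 ≤ c.2 ∧ c.2 - k ≤ c.1 ∧ c.1 ≤ k - 1 - c.2 := by
  simp only [topHalfAztecDiamond, aztecDiamond, mem_ofPred_eq]
  constructor
  · rintro ⟨h, h0⟩
    have h1 := le_max_left |c.1| |c.1 + 1|
    have h2 := le_max_right |c.1| |c.1 + 1|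
    have h3 := le_max_right |c.2| |c.2 + 1|
    have h4 := neg_abs_le c.1
    have h5 := le_abs_self (c.1 + 1)
    have h6 := le_abs_self (c.2 + 1)
    omega
  · rintro ⟨h0, h1, h2⟩
    refine ⟨?_, h0⟩
    have h3 : max |c.1| |c.1 + 1| ≤ k - c.2 :=
      max_le (abs_le.2 ⟨by omega, by omega⟩) (abs_le.2 ⟨by omega, by omega⟩)
    have h4 : max |c.2| |c.2 + 1| ≤ c.2 + 1 :=
      max_le (abs_le.2 ⟨by omega, by omega⟩) (abs_le.2 ⟨by omega, by omega⟩)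
    omega

lemma triangle_eq (n : ℕ) : triangle n = halfSquare n ∪ rightCap n := by
  unfold triangle
  congr 1
  ext c
  simp only [translateRegion, rightCap, mem_ofPred_eq, mem_topHalf, Prod.fst_sub, Prod.snd_sub]
  omega

lemma triangle'_eq (n : ℕ) : triangle' n = halfSquare n ∪ leftCap n := by
  unfold triangle'
  congr 1
  ext c
  simp only [translateRegion, leftCap, mem_ofPred_eq, mem_topHalf, Prod.fst_sub, Prod.snd_sub]
  omega

lemma isBase_halfSquare (n : ℕ) : IsBase (halfSquare n) n where
  nonneg := by positivity
  bounds := by rintro c ⟨h1, h2, h3⟩; omega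
  up := by
    rintro x y y' ⟨h1, h2, h3⟩ h4 h5
    simp only at h1 h2 h3
    refine ⟨h1, ⟨by simp only; omega, h5⟩, ?_⟩
    rcases h4.eq_or_lt with rfl | h4
    · exact h3
    · simp only; omega
  neighbor_mem := by
    rintro ⟨x, y⟩ ⟨h1, h2, h3⟩ v hv he he' hlt
    rcases hv with rfl | rfl | rfl | rfl <;>
      simp only [halfSquare, mem_ofPred_eq, Prod.mk_add_mk] at * <;> grind
  top_row := by
    rintro ⟨x, y⟩ ⟨h1, h2, h3⟩ h
    simp only at *
    grind

/-- The reflection of unit squares in the line `x = n - 1/2`. It preserves the parities of both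
coordinates of the lower left corner. -/
def mirror (n : ℤ) (c : Cell) : Cell := (2 * n - 2 - c.1, c.2)

lemma mirror_involutive (n : ℤ) : Function.Involutive (mirror n) := fun c => by
  ext <;> simp [mirror]

lemma isBase_mirror (n : ℕ) : IsBase (mirror n ⁻¹' halfSquare n) n where
  nonneg := by positivity
  bounds := by rintro c ⟨h1, h2, h3⟩; simp only [mirror] at *; omega
  up := by
    rintro x y y' h h4 h5
    exact (isBase_halfSquare n).up _ y y' h h4 h5
  neighbor_mem := by
    rintro ⟨x, y⟩ ⟨h1, h2, h3⟩ v hv he he' hlt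
    rcases hv with rfl | rfl | rfl | rfl <;>
      simp only [halfSquare, mem_ofPred_eq, Prod.mk_add_mk, mem_preimage, mirror] at * <;> grind
  top_row := by
    rintro ⟨x, y⟩ h h'
    have := (isBase_halfSquare n).top_row _ h h'
    simp only [mirror] at *
    omega

lemma mirror_rightCap (n : ℤ) : mirror n ⁻¹' rightCap n = leftCap n := by
  ext c
  simp only [mirror, rightCap, leftCap, mem_preimage, mem_ofPred_eq]
  omega

lemma mirror_leftCap (n : ℤ) : mirror n ⁻¹' leftCap n = rightCap n := by
  ext c
  simp only [mirror, rightCap, leftCap, mem_preimage, mem_ofPred_eq]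
  omega

lemma diff_cap {n : ℕ} {A B : Set Cell} (hA : ∀ c ∈ A, 2 * (n : ℤ) ≤ c.2) :
    (halfSquare n ∪ A) \ (halfSquare n ∪ B) = A \ B := by
  ext c
  have h1 := hA c
  have h2 : c ∈ halfSquare n → c.2 < 2 * (n : ℤ) := fun h => h.2.1.2
  simp only [mem_sdiff, mem_union, not_or]
  constructor
  · rintro ⟨h | h, h3, h4⟩
    · exact absurd h h3
    · exact ⟨h, h4⟩
  · rintro ⟨h, h4⟩
    exact ⟨Or.inr h, fun h5 => by have := h1 h; have := h2 h5; omega, h4⟩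

lemma triangle_diff (n : ℕ) : triangle n \ triangle' n = rightCap n \ leftCap n := by
  rw [triangle_eq, triangle'_eq, diff_cap fun c hc => hc.1]

lemma triangle'_diff (n : ℕ) : triangle' n \ triangle n = leftCap n \ rightCap n := by
  rw [triangle_eq, triangle'_eq, diff_cap fun c hc => hc.1]

lemma even_of_mem_diff {n : ℤ} {c : Cell} (hc : c ∈ rightCap n \ leftCap n) :
    Even (c.1 + c.2) := by
  obtain ⟨⟨h1, h2, h3⟩, h4⟩ := hc
  have : c.1 + c.2 = 2 * (2 * n - 1) := by
    by_contra h
    exact h4 ⟨h1, by omega, by omega⟩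
  rw [this]; exact even_two_mul _

lemma even_of_mem_diff' {n : ℤ} {c : Cell} (hc : c ∈ leftCap n \ rightCap n) :
    Even (c.1 + c.2) := by
  obtain ⟨⟨h1, h2, h3⟩, h4⟩ := hc
  have : c.1 = c.2 - 2 * n := by
    by_contra h
    exact h4 ⟨h1, by omega, by omega⟩
  rw [this]; grind

lemma glideStep_iff {R : Set Cell} {t : DominoTiling R} {d : Cell → Cell}
    (hd : ∀ c ∈ R, IsUnitVector (d c) ∧ ({c, c + d c} : Set Cell) ∈ t.tiles)
    (hd' : ∀ c v, ({c, c + v} : Set Cell) ∈ t.tiles → c ∈ R ∧ v = d c) (c e : Cell) :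
    GlideStep t.tiles c e ↔ c ∈ R ∧ e = glide d c := by
  constructor
  · rintro ⟨v, hv, rfl⟩
    obtain ⟨hc, rfl⟩ := hd' c v hv
    exact ⟨hc, rfl⟩
  · rintro ⟨hc, rfl⟩
    exact ⟨d c, (hd c hc).2, rfl⟩

lemma eq_of_add_direction_eq {R : Set Cell} {t : DominoTiling R} {d : Cell → Cell}
    (hd : ∀ c ∈ R, IsUnitVector (d c) ∧ ({c, c + d c} : Set Cell) ∈ t.tiles) {c c' : Cell}
    (hc : c ∈ R) (hc' : c' ∈ R) (he : Even (c.1 + c.2)) (he' : Even (c'.1 + c'.2))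
    (h : c + d c = c' + d c') : c = c' := by
  have heq := t.eq_of_pair_mem (hd c hc).2 (hd c' hc').2 (o := c + d c) (by simp) (by simp [h])
  have hmem : c ∈ ({c', c' + d c'} : Set Cell) := heq ▸ by simp
  rcases hmem with h1 | h1
  · exact h1
  · exact absurd (h1 ▸ he) ((hd c' hc').1.not_even_add he')

lemma transports_triangle (n : ℕ) (t : DominoTiling (triangle n)) :
    Transports (GlideStep t.tiles) (triangle n) (triangle n \ triangle' n)
      (triangle' n \ triangle n) := by
  obtain ⟨d, hd, hd'⟩ := t.exists_direction
  have hstep := glideStep_iff hd hd'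
  have hmem : ∀ c ∈ triangle n, c + d c ∈ triangle n := fun c hc =>
    t.subset _ (hd c hc).2 (by simp)
  have hinj := fun c hc c' hc' => eq_of_add_direction_eq hd (c := c) (c' := c') hc hc'
  rw [triangle_diff, triangle'_diff]
  simp only [triangle_eq] at hd hstep hmem hinj ⊢
  exact transports_of_isBase (isBase_halfSquare n) (fun c hc _ => (hd c hc).1)
    (fun c hc _ => hmem c hc) hinj hstep

/-- The reflected tiling matches `c` with `c + d' c`, where `d' c` is the reflection of the direction
`d (mirror n c)`. -/
lemma transports_triangle' (n : ℕ) (t : DominoTiling (triangle' n)) :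
    Transports (GlideStep t.tiles) (triangle' n) (triangle' n \ triangle n)
      (triangle n \ triangle' n) := by
  obtain ⟨d, hd, hd'⟩ := t.exists_direction
  have hstep := glideStep_iff hd hd'
  have hmem : ∀ c ∈ triangle' n, c + d c ∈ triangle' n := fun c hc =>
    t.subset _ (hd c hc).2 (by simp)
  have hinj := fun c hc c' hc' => eq_of_add_direction_eq hd (c := c) (c' := c') hc hc'
  refine Transports.of_involutive (mirror_involutive n) ?_
  rw [triangle_diff, triangle'_diff, preimage_sdiff, preimage_sdiff, mirror_rightCap, mirror_leftCap]
  have hR : mirror n ⁻¹' triangle' n = mirror n ⁻¹' halfSquare n ∪ rightCap n := by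
    rw [triangle'_eq, preimage_union, mirror_leftCap]
  have hμ : ∀ c v : Cell, mirror n c + v = mirror n (c + (-v.1, v.2)) := fun c v => by
    ext <;> simp [mirror]; ring
  have hμe : ∀ c : Cell, Even (c.1 + c.2) → Even ((mirror n c).1 + (mirror n c).2) := fun c hc => by
    simp only [mirror]; grind
  rw [hR]
  refine transports_of_isBase (d := fun c => (-(d (mirror n c)).1, (d (mirror n c)).2))
    (isBase_mirror n) (fun c hc _ => ?_) (fun c hc _ => ?_) (fun c hc c' hc' he he' h => ?_)
    fun c e => ?_ <;> rw [← hR] at *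
  · rcases (hd _ hc).1 with h | h | h | h <;> simp [h, IsUnitVector]
  · rw [mem_preimage, ← hμ]
    exact hmem _ hc
  · refine (mirror_involutive n).injective (hinj _ hc _ hc' (hμe c he) (hμe c' he') ?_)
    rw [hμ, hμ, h]
  · rw [hstep, mem_preimage]
    refine and_congr_right fun _ => ?_
    rw [glide, hμ, hμ, (mirror_involutive n).injective.eq_iff, glide]

end AztecTriangle


/-- The bijection between the domino tilings of `𝒯ₙ` and of `𝒯'ₙ` is the one given by shifting a
tiling along the gliding paths which start at those unit squares of its region that do not belong
to the other region; its inverse is the analogous map in the other direction. -/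
theorem corollary5p2 (n : ℕ) :
    ∃ Φ : AztecTriangle.DominoTiling (AztecTriangle.triangle n) ≃
        AztecTriangle.DominoTiling (AztecTriangle.triangle' n),
      (∀ t : AztecTriangle.DominoTiling (AztecTriangle.triangle n),
        (Φ t).tiles = AztecTriangle.shift t.tiles
          (AztecTriangle.triangle n \ AztecTriangle.triangle' n)) ∧
      (∀ t' : AztecTriangle.DominoTiling (AztecTriangle.triangle' n),
        (Φ.symm t').tiles = AztecTriangle.shift t'.tiles
          (AztecTriangle.triangle' n \ AztecTriangle.triangle n)) := by
  have hS : ∀ c ∈ AztecTriangle.triangle n \ AztecTriangle.triangle' n, Even (c.1 + c.2) := by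
    rw [AztecTriangle.triangle_diff]
    exact fun c hc => AztecTriangle.even_of_mem_diff hc
  have hS' : ∀ c ∈ AztecTriangle.triangle' n \ AztecTriangle.triangle n, Even (c.1 + c.2) := by
    rw [AztecTriangle.triangle'_diff]
    exact fun c hc => AztecTriangle.even_of_mem_diff' hc
  exact ⟨{ toFun := fun t => t.shiftTiling (AztecTriangle.transports_triangle n t) hS
           invFun := fun t' => t'.shiftTiling (AztecTriangle.transports_triangle' n t') hS'
           left_inv := fun t => AztecTriangle.DominoTiling.ext
             (t.shift_shift (AztecTriangle.transports_triangle n t) hS)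
           right_inv := fun t' => AztecTriangle.DominoTiling.ext
             (t'.shift_shift (AztecTriangle.transports_triangle' n t') hS') },
    fun _ => rfl, fun _ => rfl⟩
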